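/- Fix integers $d,N\ge 1$ and constants $L_0,L_1,r_u>0$, $0<\varepsilon<1$, $B\ge 0$. Put $\gamma=1-\frac{\varepsilon}{4N^2}$ and $\alpha=2+\frac{60N^2}{1-\gamma^2}$. For an integer $T\ge 1$ put $$\eta=\frac{1}{\sqrt{3\alpha}\,d\,L_0\,T^{1/2}},\qquad \delta=\frac{2}{T^{1/4}}.$$ Setting. Let $\mathcal X\subset\mathbb R^d$ be closed and convex with $r_l\mathbb B^d\subseteq\mathcal X\subseteq r_u\mathbb B^d$ for some $r_l>0$, where $\mathbb B^d$ is the closed unit ball and $\mathbb S^d$ the unit sphere of $\mathbb R^d$, and let $\mathcal X_\delta=\{x+\delta v: x\in\mathcal X,\ v\in\mathbb S^d\}$. Let $A=[a_{ij}]$ be a nonnegative doubly stochastic matrix that is a weight matrix of an undirected graph on $\{1,\dots,N\}$ with self-loops: $a_{ij}>\varepsilon$ if $i=j$ or $\{i,j\}$ is an edge, and $a_{ij}=0$ otherwise. For $-1\le t\le T$ and $1\le i\le N$ let $f_t^i:\mathbb R^d\to\mathbb R$ be a (deterministic) function which on $\mathcal X+\delta\mathbb B^d$ is convex, $L_0$-Lipschitz,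 and differentiable with $L_1$-Lipschitz gradient. Put $\theta_{i,t}=\sup_{x\in\mathcal X_\delta}|f_t^i(x)-f_{t-1}^i(x)|$ and $\Theta_T=\sum_{t=1}^T\sum_{i=1}^N\theta_{i,t}$, and suppose that $\theta_{i,0}\le B$ for all $i$. Algorithm. Let $u_t^i$ ($-1\le t\le T$, $1\le i\le N$) be independent random vectors, uniformly distributed on $\mathbb S^d$. Starting from arbitrary points $x_{-1}^i,x_0^i\in\mathcal X$, for $t=0,\dots,T$ and $i=1,\dots,N$ let $$\widetilde g_t^i=\frac d\delta\big(f_t^i(x_t^i+\delta u_t^i)-f_{t-1}^i(x_{t-1}^i+\delta u_{t-1}^i)\big)u_t^i,\qquad x_{t+1}^i=\Pi_{\mathcal X}\Big[\sum_{j=1}^N a_{ij}\big(x_t^j-\eta\,\widetilde g_t^j\big)\Big],$$ where $\Pi_{\mathcal X}$ is the Euclidean projection onto $\mathcal X$. Claim. There is a constant $C$ depending only on $d,N,L_0,L_1,\varepsilon,r_u,B$ such that for every $T\ge1$, all data as above and every $x^*\in\arg\min_{x\in\mathcal X}\sum_{t=1}^T\sum_{i=1}^N f_t^i(x)$, the total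 excess loss $\sum_{t=1}^T\sum_{i=1}^N[f_t^i(x_t^i)-f_t^i(x^*)]$ is integrable and the expected static regret satisfies $$R_g^T=\mathbb E\Big[\sum_{t=1}^T\sum_{i=1}^N\big(f_t^i(x_t^i)-f_t^i(x^*)\big)\Big]\le C\,\max\big\{T^{1/2},\Theta_T^2\big\}.$$ -/

import Mathlib

open MeasureTheory ProbabilityTheory

/-- The decision space `ℝ^d` with its Euclidean norm. -/
abbrev Vec (d : ℕ) : Type := EuclideanSpace ℝ (Fin d)

/-- The unit sphere of `ℝ^d`. -/
abbrev UnitSphere (d : ℕ) : Type := Metric.sphere (0 : Vec d) 1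

/-- The uniform distribution on the unit sphere: the normalized surface measure. -/
noncomputable def uniformSphere (d : ℕ) : Measure (UnitSphere d) :=
  ((volume : Measure (Vec d)).toSphere Set.univ)⁻¹ • (volume : Measure (Vec d)).toSphere

/-- The set `{x + δ v : x ∈ X, ‖v‖ = 1}` of points at which losses are queried. -/
def queryRegion {d : ℕ} (X : Set (Vec d)) (δ : ℝ) : Set (Vec d) :=
  {z | ∃ x ∈ X, ∃ v : Vec d, ‖v‖ = 1 ∧ z = x + δ • v}

/-- The set `{x + δ v : x ∈ X, ‖v‖ ≤ 1}`. -/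
def ballRegion {d : ℕ} (X : Set (Vec d)) (δ : ℝ) : Set (Vec d) :=
  {z | ∃ x ∈ X, ∃ v : Vec d, ‖v‖ ≤ 1 ∧ z = x + δ • v}

/-- A loss that is convex, `L₀`-Lipschitz, and differentiable with `L₁`-Lipschitz gradient
on the set `D`. -/
structure IsSmoothConvexLoss {d : ℕ} (D : Set (Vec d)) (L₀ L₁ : ℝ) (f : Vec d → ℝ) : Prop where
  convex : ConvexOn ℝ D f
  lipschitz : ∀ x ∈ D, ∀ y ∈ D, |f x - f y| ≤ L₀ * ‖x - y‖
  differentiable : ∀ x ∈ D, DifferentiableAt ℝ f x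
  smooth : ∀ x ∈ D, ∀ y ∈ D, ‖gradient f x - gradient f y‖ ≤ L₁ * ‖x - y‖

/-- `A` is a doubly stochastic weight matrix adapted to the undirected graph `G` with self-loops:
all weights along edges and self-loops exceed `ε`, all other weights vanish. -/
structure IsNetworkMatrix {N : ℕ} (G : SimpleGraph (Fin N)) (A : Matrix (Fin N) (Fin N) ℝ)
    (ε : ℝ) : Prop where
  stochastic : A ∈ doublyStochastic ℝ (Fin N)
  self_weight : ∀ i, ε < A i i
  edge_weight : ∀ i j, G.Adj j i → ε < A i j
  non_edge : ∀ i j, i ≠ j → ¬ G.Adj j i → A i j = 0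

/-- `p` is the Euclidean projection of `y` onto `X`. -/
def IsProjection {d : ℕ} (X : Set (Vec d)) (y p : Vec d) : Prop :=
  p ∈ X ∧ ∀ z ∈ X, ‖y - p‖ ≤ ‖y - z‖

/-- The one-point residual feedback estimator of agent `i` at time `t`, for given losses `f`,
decisions `x` and sampled directions `u`. -/
noncomputable def orfEstimator {d N : ℕ} (δ : ℝ) (f : ℤ → Fin N → Vec d → ℝ)
    (u : ℤ → Fin N → UnitSphere d) (x : ℤ → Fin N → Vec d) (t : ℤ) (i : Fin N) : Vec d :=
  ((d : ℝ) / δ * (f t i (x t i + δ • (u t i : Vec d))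
    - f (t - 1) i (x (t - 1) i + δ • (u (t - 1) i : Vec d)))) • (u t i : Vec d)

/-- `x` is the decision sequence that the distributed residual-feedback algorithm produces over
the rounds `t = 0, …, T` along the sampled directions `u`, when it is started in `x₀` at time `0`.
The estimator of round `0` refers to time `-1`, where the decisions are `xₚ`. -/
structure IsORFRun {d N : ℕ} (X : Set (Vec d)) (A : Matrix (Fin N) (Fin N) ℝ) (η δ : ℝ) (T : ℕ)
    (f : ℤ → Fin N → Vec d → ℝ) (xₚ x₀ : Fin N → Vec d)
    (u : ℤ → Fin N → UnitSphere d) (x : ℤ → Fin N → Vec d) : Prop where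
  previous : ∀ i, x (-1) i = xₚ i
  start : ∀ i, x 0 i = x₀ i
  step : ∀ t : ℤ, 0 ≤ t → t ≤ T → ∀ i,
    IsProjection X (∑ j, A i j • (x t j - η • orfEstimator δ f u x t j)) (x (t + 1) i)

/-- The sampled directions: at the times `-1, 0, …, T`, mutually independent over all times and
agents and uniformly distributed on the unit sphere. -/
structure IsUniformSampling {Ω : Type*} [MeasurableSpace Ω] {d N : ℕ} (T : ℕ) (μ : Measure Ω)
    (u : ℤ → Fin N → Ω → UnitSphere d) : Prop where
  measurable : ∀ t : ℤ, -1 ≤ t → t ≤ T → ∀ i, Measurable (u t i)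
  uniform : ∀ t : ℤ, -1 ≤ t → t ≤ T → ∀ i, μ.map (u t i) = uniformSphere d
  indep : iIndepFun (fun p : ↥(Set.Icc (-1 : ℤ) T) × Fin N => u p.1 p.2) μ

/-- The increasing rate `θ_{i,t}`: the supremum of `|f_t^i - f_{t-1}^i|` over the query region. -/
noncomputable def increasingRate {d N : ℕ} (X : Set (Vec d)) (δ : ℝ)
    (f : ℤ → Fin N → Vec d → ℝ) (t : ℤ) (i : Fin N) : ℝ :=
  sSup ((fun x => |f t i x - f (t - 1) i x|) '' queryRegion X δ)

/-- The accumulated increasing rate `Θ_T`. -/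
noncomputable def accumulatedRate {d N : ℕ} (X : Set (Vec d)) (δ : ℝ) (T : ℕ)
    (f : ℤ → Fin N → Vec d → ℝ) : ℝ :=
  ∑ t ∈ Finset.Icc (1 : ℤ) T, ∑ i, increasingRate X δ f t i

/-- The cumulative excess loss, over the rounds `1, …, T` and all agents, of the decisions `x`
over the fixed decision `y`. Its expectation for a best `y` is the static regret. -/
noncomputable def excessLoss {d N : ℕ} (T : ℕ) (f : ℤ → Fin N → Vec d → ℝ)
    (x : ℤ → Fin N → Vec d) (y : Vec d) : ℝ :=
  ∑ t ∈ Finset.Icc (1 : ℤ) T, ∑ i, (f t i (x t i) - f t i y)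

/-- The constant `γ = 1 - ε / (4 N²)`. -/
noncomputable def mixingRate (N : ℕ) (ε : ℝ) : ℝ := 1 - ε / (4 * (N : ℝ) ^ 2)

/-- The constant `α = 2 + 60 N² / (1 - γ²)`. -/
noncomputable def alphaConst (N : ℕ) (ε : ℝ) : ℝ :=
  2 + 60 * (N : ℝ) ^ 2 / (1 - mixingRate N ε ^ 2)

/-- The step size `η = 1 / (√(3α) d L₀ T^{1/2})`. -/
noncomputable def stepSize (d N : ℕ) (ε L₀ : ℝ) (T : ℕ) : ℝ :=
  1 / (Real.sqrt (3 * alphaConst N ε) * d * L₀ * (T : ℝ) ^ (1 / 2 : ℝ))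

/-- The smoothing radius `δ = 2 / T^{1/4}`. -/
noncomputable def smoothingRadius (T : ℕ) : ℝ := 2 / (T : ℝ) ^ (1 / 4 : ℝ)

/-!
The proof splits into an analytic, a pathwise and a probabilistic part.

*Analysis.*  For `F` Lipschitz, the divergence theorem on the unit ball turns the spherical integral
of `F u * ⟪u, z⟫` into the integral of the derivative of `F` along `z` over the ball
(`setIntegral_ball_lineDeriv`); it is obtained from integration by parts for Lipschitz functions
against a radial cutoff whose transition annulus shrinks to the sphere.  Hence the one-point
estimator averages to the gradient of the smoothed loss, and convexity together with the symmetry of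
the ball gives `f x - f y - L₁ δ² ≤ 𝔼 ⟪estimator, x - y⟫`
(`IsSmoothConvexLoss.sub_le_integral_estimator`).  The bias must be of second order in `δ`, since it
is summed over `T` rounds with `δ² = 4 / √T`.

*Pathwise bound.*  The averaging step of a doubly stochastic matrix with diagonal above `ε`
decreases `∑ ‖x i - y‖²` by at least `ε` times the squared displacement it causes
(`IsNetworkMatrix.sum_norm_sq_average_sub_add_le`), so no mixing estimate and no connectivity is
needed.  The squared norm of the residual-feedback estimator is at most a drift term, plus a
multiple of the last squared displacement, plus a term independent of `δ`
(`norm_sq_orfEstimator_le`).  For the given step size the displacement term is absorbed by the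
dissipation, and telescoping `∑ ‖x t - y‖² + ε / 2 * ∑ ‖x t - x (t - 1)‖²` bounds
`2 η ∑ ⟪estimator, x t - y⟫` along every realization (`IsORFRun.sum_inner_orfEstimator_le`).

*Probability.*  The decision and the subtracted residual of round `t` are measurable with respect to
the directions sampled before `t`, which are independent of the direction of round `t`.  Fubini's
theorem then carries the one-point estimate over to the random decisions
(`integral_sub_le_integral_estimator`), and inserting the parameters gives the regret bound.
-/

/-! ### Integration over the unit sphere -/

theorem integral_norm_mul_direction {E : Type*} [NormedAddCommGroup E] [NormedSpace ℝ E]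
    [FiniteDimensional ℝ E] [Nontrivial E] [MeasurableSpace E] [BorelSpace E]
    (μ : Measure E) [μ.IsAddHaarMeasure] (w : ℝ → ℝ) (q : E → ℝ) :
    ∫ v, w ‖v‖ * q (‖v‖⁻¹ • v) ∂μ =
      (∫ u : Metric.sphere (0 : E) 1, q u ∂μ.toSphere) *
        ∫ r in Set.Ioi (0 : ℝ), r ^ (Module.finrank ℝ E - 1) * w r := by
  calc
    ∫ v, w ‖v‖ * q (‖v‖⁻¹ • v) ∂μ
      = ∫ v : ({(0)}ᶜ : Set E), w ‖v.1‖ * q (‖v.1‖⁻¹ • v.1) ∂(μ.comap (↑)) := by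
        rw [integral_subtype_comap (measurableSet_singleton _).compl
          fun v : E ↦ w ‖v‖ * q (‖v‖⁻¹ • v), restrict_compl_singleton]
    _ = ∫ p : Metric.sphere (0 : E) 1 × Set.Ioi (0 : ℝ), q p.1 * w p.2
          ∂μ.toSphere.prod (.volumeIoiPow (Module.finrank ℝ E - 1)) := by
        have := μ.measurePreserving_homeomorphUnitSphereProd.integral_comp
          (Homeomorph.measurableEmbedding _)
          (fun p : Metric.sphere (0 : E) 1 × Set.Ioi (0 : ℝ) ↦ q p.1 * w p.2)
        rw [← this]
        refine integral_congr_ae (.of_forall fun v ↦ ?_)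
        simp [mul_comm]
    _ = (∫ u : Metric.sphere (0 : E) 1, q u ∂μ.toSphere) *
          ∫ r : Set.Ioi (0 : ℝ), w r ∂.volumeIoiPow (Module.finrank ℝ E - 1) :=
        integral_prod_mul (fun u : Metric.sphere (0 : E) 1 ↦ q u)
          (fun r : Set.Ioi (0 : ℝ) ↦ w r)
    _ = _ := by
        congr 1
        simp only [Measure.volumeIoiPow, ENNReal.ofReal]
        rw [integral_withDensity_eq_integral_smul,
          integral_subtype_comap measurableSet_Ioi
            fun a ↦ Real.toNNReal (a ^ (Module.finrank ℝ E - 1)) • w a,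
          setIntegral_congr_fun measurableSet_Ioi fun x hx ↦ ?_]
        · rw [NNReal.smul_def, Real.coe_toNNReal _ (pow_nonneg (le_of_lt hx) _), smul_eq_mul]
        · exact (measurable_subtype_coe.pow_const _).real_toNNReal

/-- The Lipschitz cutoff that is `1` on the ball of radius `1 - h`, vanishes off the unit ball,
and is linear in the norm in between. -/
noncomputable def radialCutoff {E : Type*} [NormedAddCommGroup E] (h : ℝ) (v : E) : ℝ :=
  max 0 (min 1 (h⁻¹ * (1 - ‖v‖)))

section Cutoff

variable {E : Type*} [NormedAddCommGroup E]

theorem lipschitzWith_radialCutoff (h : ℝ) :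
    LipschitzWith (Real.nnabs h⁻¹) (radialCutoff (E := E) h) := by
  have h₁ : LipschitzWith (Real.nnabs h⁻¹) fun v : E ↦ h⁻¹ * (1 - ‖v‖) := by
    refine LipschitzWith.of_dist_le_mul fun v w ↦ ?_
    rw [Real.dist_eq, ← mul_sub, abs_mul, sub_sub_sub_cancel_left, abs_sub_comm, dist_eq_norm]
    simpa using mul_le_mul_of_nonneg_left (abs_norm_sub_norm_le v w) (abs_nonneg h⁻¹)
  exact (h₁.const_min 1).const_max 0

theorem radialCutoff_nonneg (h : ℝ) (v : E) : 0 ≤ radialCutoff h v := le_max_left _ _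

theorem radialCutoff_le_one (h : ℝ) (v : E) : radialCutoff h v ≤ 1 :=
  max_le zero_le_one (min_le_left _ _)

theorem radialCutoff_eq_one {h : ℝ} (hh : 0 < h) {v : E} (hv : ‖v‖ ≤ 1 - h) :
    radialCutoff h v = 1 := by
  have : 1 ≤ h⁻¹ * (1 - ‖v‖) := by
    rw [inv_mul_eq_div, one_le_div hh]; linarith
  rw [radialCutoff, min_eq_left this, max_eq_right zero_le_one]

theorem radialCutoff_eq_zero {h : ℝ} (hh : 0 < h) {v : E} (hv : 1 ≤ ‖v‖) :
    radialCutoff h v = 0 := by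
  have : h⁻¹ * (1 - ‖v‖) ≤ 0 := mul_nonpos_of_nonneg_of_nonpos (by positivity) (by linarith)
  rw [radialCutoff, max_eq_left ((min_le_right _ _).trans this)]

theorem radialCutoff_eq_mul {h : ℝ} (hh : 0 < h) {v : E} (h₁ : 1 - h ≤ ‖v‖) (h₂ : ‖v‖ ≤ 1) :
    radialCutoff h v = h⁻¹ * (1 - ‖v‖) := by
  have h₃ : h⁻¹ * (1 - ‖v‖) ≤ 1 := by rw [inv_mul_eq_div, div_le_one hh]; linarith
  have h₄ : 0 ≤ h⁻¹ * (1 - ‖v‖) := mul_nonneg (by positivity) (by linarith)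
  rw [radialCutoff, min_eq_right h₃, max_eq_right h₄]

theorem hasCompactSupport_radialCutoff [ProperSpace E] {h : ℝ} (hh : 0 < h) :
    HasCompactSupport (radialCutoff (E := E) h) := by
  refine HasCompactSupport.intro (isCompact_closedBall (0 : E) 1) fun v hv ↦ ?_
  refine radialCutoff_eq_zero hh ?_
  simp only [mem_closedBall_zero_iff, not_le] at hv
  exact hv.le

theorem lineDeriv_radialCutoff_of_norm_lt [NormedSpace ℝ E] {h : ℝ} (hh : 0 < h) {v : E}
    (hv : ‖v‖ < 1 - h) (z : E) : lineDeriv ℝ (radialCutoff h) v z = 0 := by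
  have h₁ : radialCutoff h =ᶠ[nhds v] fun _ ↦ (1 : ℝ) := by
    filter_upwards [continuous_norm.continuousAt.eventually_lt continuousAt_const hv] with w hw
    exact radialCutoff_eq_one hh hw.le
  rw [h₁.lineDeriv_eq]
  simp [lineDeriv]

theorem lineDeriv_radialCutoff_of_one_lt_norm [NormedSpace ℝ E] {h : ℝ} (hh : 0 < h) {v : E}
    (hv : 1 < ‖v‖) (z : E) : lineDeriv ℝ (radialCutoff h) v z = 0 := by
  have h₁ : radialCutoff h =ᶠ[nhds v] fun _ ↦ (0 : ℝ) := by
    filter_upwards [continuousAt_const.eventually_lt continuous_norm.continuousAt hv] with w hw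
    exact radialCutoff_eq_zero hh hw.le
  rw [h₁.lineDeriv_eq]
  simp [lineDeriv]

end Cutoff

theorem hasLineDerivAt_norm {E : Type*} [NormedAddCommGroup E] [InnerProductSpace ℝ E]
    {v : E} (hv : v ≠ 0) (z : E) :
    HasLineDerivAt ℝ (fun w : E ↦ ‖w‖) (inner ℝ (‖v‖⁻¹ • v) z) v z := by
  have h₁ : HasFDerivAt (fun w : E ↦ ‖w‖ ^ 2) (2 • innerSL ℝ v) v :=
    (hasStrictFDerivAt_norm_sq v).hasFDerivAt
  have h₂ := h₁.sqrt (by simpa using hv)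
  simp only [Real.sqrt_sq (norm_nonneg _)] at h₂
  have h₃ := h₂.hasLineDerivAt z
  convert h₃ using 1
  simp [inner_smul_left]
  ring

theorem lineDeriv_radialCutoff_of_mem_annulus {E : Type*} [NormedAddCommGroup E]
    [InnerProductSpace ℝ E] {h : ℝ} (hh : 0 < h) (hh₁ : h < 1) {v : E} (h₁ : 1 - h < ‖v‖)
    (h₂ : ‖v‖ < 1) (z : E) :
    lineDeriv ℝ (radialCutoff h) v z = -(h⁻¹ * inner ℝ (‖v‖⁻¹ • v) z) := by
  have hv : v ≠ 0 := by
    rintro rfl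
    simp at h₁
    linarith
  have h₃ : radialCutoff h =ᶠ[nhds v] fun w ↦ h⁻¹ * (1 - ‖w‖) := by
    filter_upwards [continuousAt_const.eventually_lt continuous_norm.continuousAt h₁,
      continuous_norm.continuousAt.eventually_lt continuousAt_const h₂] with w hw₁ hw₂
    exact radialCutoff_eq_mul hh hw₁.le hw₂.le
  rw [h₃.lineDeriv_eq]
  have h₄ : HasDerivAt (fun t : ℝ ↦ ‖v + t • z‖) (inner ℝ (‖v‖⁻¹ • v) z) 0 :=
    hasLineDerivAt_norm hv z
  have h₅ := ((h₄.const_sub 1).const_mul h⁻¹)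
  rw [mul_neg] at h₅
  exact h₅.deriv

section Divergence

variable {E : Type*} [NormedAddCommGroup E] [InnerProductSpace ℝ E] [FiniteDimensional ℝ E]
  [Nontrivial E] [MeasurableSpace E] [BorelSpace E] (μ : Measure E) [μ.IsAddHaarMeasure]

/-- Integration by parts against the radial cutoff, whose gradient is `-h⁻¹ v / ‖v‖` on the
annulus `1 - h ≤ ‖v‖ < 1` and vanishes elsewhere. -/
theorem integral_lineDeriv_mul_radialCutoff {F : E → ℝ} {K : NNReal} (hF : LipschitzWith K F)
    (z : E) {h : ℝ} (hh : 0 < h) (hh₁ : h < 1) :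
    ∫ v, lineDeriv ℝ F v z * radialCutoff h v ∂μ =
      ∫ v in Metric.ball (0 : E) 1 \ Metric.ball 0 (1 - h),
        h⁻¹ * (F v * inner ℝ (‖v‖⁻¹ • v) z) ∂μ := by
  rw [hF.integral_lineDeriv_mul_eq (lipschitzWith_radialCutoff h)
    (hasCompactSupport_radialCutoff hh) z,
    ← integral_indicator (measurableSet_ball.diff measurableSet_ball)]
  have h₁ : ∀ᵐ v ∂μ, v ∉ Metric.sphere (0 : E) 1 :=
    measure_eq_zero_iff_ae_notMem.1 (Measure.addHaar_sphere μ 0 1)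
  have h₂ : ∀ᵐ v ∂μ, v ∉ Metric.sphere (0 : E) (1 - h) :=
    measure_eq_zero_iff_ae_notMem.1 (Measure.addHaar_sphere μ 0 (1 - h))
  refine integral_congr_ae ?_
  filter_upwards [h₁, h₂] with v hv₁ hv₂
  rw [mem_sphere_zero_iff_norm] at hv₁ hv₂
  rcases lt_or_gt_of_ne hv₁ with hv₁ | hv₁
  · rcases lt_or_gt_of_ne hv₂ with hv₂ | hv₂
    · rw [lineDeriv_radialCutoff_of_norm_lt hh hv₂, Set.indicator_of_notMem, zero_mul]
      simp [hv₂]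
    · rw [lineDeriv_radialCutoff_of_mem_annulus hh hh₁ hv₂ hv₁, Set.indicator_of_mem,
        inner_neg_right]
      · ring
      · simp [hv₁, hv₂.le]
  · rw [lineDeriv_radialCutoff_of_one_lt_norm hh hv₁, Set.indicator_of_notMem, zero_mul]
    simp [hv₁.le]

theorem measureReal_annulus {h : ℝ} (hh : 0 < h) (hh₁ : h < 1) :
    μ.real (Metric.ball (0 : E) 1 \ Metric.ball 0 (1 - h)) =
      (1 - (1 - h) ^ Module.finrank ℝ E) * μ.real (Metric.ball (0 : E) 1) := by
  rw [measureReal_sdiff (Metric.ball_subset_ball (by linarith)) measurableSet_ball,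
    measureReal_def (s := Metric.ball (0 : E) (1 - h)), Measure.addHaar_ball μ 0 (by linarith),
    ENNReal.toReal_mul, ENNReal.toReal_ofReal (pow_nonneg (by linarith) _), ← measureReal_def]
  ring

theorem integral_annulus_direction (q : E → ℝ) {h : ℝ} (hh₁ : h < 1) :
    ∫ v in Metric.ball (0 : E) 1 \ Metric.ball 0 (1 - h), q (‖v‖⁻¹ • v) ∂μ =
      (∫ u : Metric.sphere (0 : E) 1, q u ∂μ.toSphere) *
        ∫ r in Set.Ico (1 - h) 1, r ^ (Module.finrank ℝ E - 1) := by
  have h₁ := integral_norm_mul_direction μ ((Set.Ico (1 - h) 1).indicator 1) q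
  have h₂ : ∀ r : ℝ, r ^ (Module.finrank ℝ E - 1) * (Set.Ico (1 - h) 1).indicator 1 r =
      (Set.Ico (1 - h) 1).indicator (fun r ↦ r ^ (Module.finrank ℝ E - 1)) r := fun r ↦ by
    by_cases hr : r ∈ Set.Ico (1 - h) 1 <;> simp [hr]
  have h₃ : Set.Ioi (0 : ℝ) ∩ Set.Ico (1 - h) 1 = Set.Ico (1 - h) 1 :=
    Set.inter_eq_self_of_subset_right fun r hr ↦ lt_of_lt_of_le (by linarith) hr.1
  simp_rw [h₂] at h₁
  rw [setIntegral_indicator measurableSet_Ico, h₃] at h₁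
  rw [← h₁, ← integral_indicator (measurableSet_ball.diff measurableSet_ball)]
  refine integral_congr_ae (.of_forall fun v ↦ ?_)
  by_cases hv : v ∈ Metric.ball (0 : E) 1 \ Metric.ball 0 (1 - h)
  · have hv' : ‖v‖ ∈ Set.Ico (1 - h) 1 := by simpa [and_comm] using hv
    simp [hv, hv']
  · have hv' : ‖v‖ ∉ Set.Ico (1 - h) 1 := by simpa [and_comm] using hv
    simp only [Set.indicator_of_notMem hv, Set.indicator_of_notMem hv', zero_mul]

theorem abs_inv_mul_setIntegral_pow_sub_one_le (n : ℕ) {h : ℝ} (hh : 0 < h) (hh₁ : h < 1) :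
    |h⁻¹ * (∫ r in Set.Ico (1 - h) 1, r ^ n) - 1| ≤ 1 - (1 - h) ^ n := by
  have hint : IntegrableOn (fun r : ℝ ↦ r ^ n) (Set.Ico (1 - h) 1) :=
    ((continuous_pow n).integrableOn_Icc (a := 1 - h) (b := 1)).mono_set Set.Ico_subset_Icc_self
  have h₁ : ∫ r in Set.Ico (1 - h) 1, r ^ n ≤ h := by
    have := setIntegral_mono_on hint (integrableOn_const (C := (1 : ℝ)) (by simp))
      measurableSet_Ico fun r hr ↦ pow_le_one₀ (n := n) (by linarith [hr.1]) hr.2.le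
    simpa [measureReal_def, hh.le] using this
  have h₂ : h * (1 - h) ^ n ≤ ∫ r in Set.Ico (1 - h) 1, r ^ n := by
    have := setIntegral_mono_on (integrableOn_const (C := (1 - h) ^ n) (by simp)) hint
      measurableSet_Ico fun r hr ↦ pow_le_pow_left₀ (by linarith) hr.1 n
    simpa [measureReal_def, hh.le] using this
  rw [abs_le]
  have h₃ : h⁻¹ * (h * (1 - h) ^ n) = (1 - h) ^ n := by field_simp
  have h₄ : h⁻¹ * h = 1 := by field_simp
  have h₅ := mul_le_mul_of_nonneg_left h₁ (inv_pos.2 hh).le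
  have h₆ := mul_le_mul_of_nonneg_left h₂ (inv_pos.2 hh).le
  have h₇ : (1 - h) ^ n ≤ 1 := pow_le_one₀ (by linarith) (by linarith)
  constructor <;> linarith

/-- The divergence theorem on the unit ball for the field `F z` with `F` Lipschitz.  Cutting `F`
off linearly in an annulus of width `h` turns it into an integration by parts on the whole space;
the three errors made on the annulus vanish with `h`. -/
theorem setIntegral_ball_lineDeriv {F : E → ℝ} {K : NNReal} (hF : LipschitzWith K F) (z : E) :
    ∫ v in Metric.ball (0 : E) 1, lineDeriv ℝ F v z ∂μ =
      ∫ u : Metric.sphere (0 : E) 1, F u * inner ℝ (u : E) z ∂μ.toSphere := by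
  set D := ∫ v in Metric.ball (0 : E) 1, lineDeriv ℝ F v z ∂μ with hD
  set I := ∫ u : Metric.sphere (0 : E) 1, F u * inner ℝ (u : E) z ∂μ.toSphere with hI
  set n := Module.finrank ℝ E
  set V := μ.real (Metric.ball (0 : E) 1)
  set M : ℝ := K * ‖z‖ with hM
  have hM₀ : 0 ≤ M := by positivity
  have hderiv : ∀ v, |lineDeriv ℝ F v z| ≤ M := fun v ↦
    norm_lineDeriv_le_of_lipschitz ℝ hF
  have hmeas : Measurable fun v ↦ lineDeriv ℝ F v z := measurable_lineDeriv hF.continuous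
  have hF' : Measurable F := hF.continuous.measurable
  suffices hbound : ∀ h : ℝ, 0 < h → h < 1 →
      |D - I| ≤ 2 * M * ((1 - (1 - h) ^ n) * V) + |I| * (1 - (1 - h) ^ (n - 1)) by
    have hlim : Filter.Tendsto (fun h : ℝ ↦
        2 * M * ((1 - (1 - h) ^ n) * V) + |I| * (1 - (1 - h) ^ (n - 1)))
        (nhdsWithin 0 (Set.Ioi 0)) (nhds 0) := by
      have hc : Continuous fun h : ℝ ↦
          2 * M * ((1 - (1 - h) ^ n) * V) + |I| * (1 - (1 - h) ^ (n - 1)) := by fun_prop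
      simpa using (hc.tendsto 0).mono_left (nhdsWithin_le_nhds (s := Set.Ioi 0))
    have h₀ : |D - I| ≤ 0 := by
      refine ge_of_tendsto hlim ?_
      filter_upwards [Ioo_mem_nhdsGT (zero_lt_one' ℝ)] with h hh using hbound h hh.1 hh.2
    exact sub_eq_zero.1 (abs_nonpos_iff.1 h₀)
  intro h hh hh₁
  set S : Set E := Metric.ball (0 : E) 1 \ Metric.ball 0 (1 - h) with hS
  have hSm : MeasurableSet S := measurableSet_ball.diff measurableSet_ball
  have hSfin : μ S ≠ ⊤ := (measure_mono_top Set.sdiff_subset |>.mt measure_ball_lt_top.ne)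
  have hSV : μ.real S = (1 - (1 - h) ^ n) * V := measureReal_annulus μ hh hh₁
  set J := ∫ v, lineDeriv ℝ F v z * radialCutoff h v ∂μ with hJ
  have hcut : Continuous (radialCutoff (E := E) h) := (lipschitzWith_radialCutoff h).continuous
  -- the cutoff differs from the indicator of the ball only on the annulus
  have e₁ : |D - J| ≤ M * μ.real S := by
    have i₁ : Integrable ((Metric.ball (0 : E) 1).indicator fun v ↦ lineDeriv ℝ F v z) μ :=
      (Measure.integrableOn_of_bounded measure_ball_lt_top.ne hmeas.aestronglyMeasurable
        (.of_forall hderiv)).integrable_indicator measurableSet_ball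
    have i₂ : Integrable (fun v ↦ lineDeriv ℝ F v z * radialCutoff h v) μ :=
      (hcut.integrable_of_hasCompactSupport (hasCompactSupport_radialCutoff hh)).bdd_mul
        (c := M) hmeas.aestronglyMeasurable (.of_forall hderiv)
    rw [hD, hJ, ← integral_indicator measurableSet_ball, ← integral_sub i₁ i₂]
    have i₃ : Integrable (S.indicator fun _ ↦ M) μ :=
      (integrableOn_const hSfin).integrable_indicator hSm
    rw [← Real.norm_eq_abs]
    refine (norm_integral_le_of_norm_le i₃ (.of_forall fun v ↦ ?_)).trans_eq ?_
    · by_cases hv₁ : ‖v‖ < 1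
      · have hv₁' : v ∈ Metric.ball (0 : E) 1 := by simpa using hv₁
        rw [Set.indicator_of_mem hv₁']
        by_cases hv₂ : ‖v‖ < 1 - h
        · rw [radialCutoff_eq_one hh hv₂.le, mul_one, sub_self, norm_zero]
          exact Set.indicator_nonneg (fun _ _ ↦ hM₀) _
        · have hv : v ∈ S := by simp [hS, hv₁, not_lt.1 hv₂]
          rw [Set.indicator_of_mem hv, ← mul_one_sub, norm_mul]
          have h₃ : ‖1 - radialCutoff h v‖ ≤ 1 := by
            rw [Real.norm_eq_abs, abs_le]
            constructor <;> linarith [radialCutoff_nonneg h v, radialCutoff_le_one h v]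
          exact (mul_le_of_le_one_right (norm_nonneg _) h₃).trans (hderiv v)
      · have hv₁' : v ∉ Metric.ball (0 : E) 1 := by simpa using hv₁
        rw [Set.indicator_of_notMem hv₁', radialCutoff_eq_zero hh (not_lt.1 hv₁), mul_zero,
          sub_self, norm_zero]
        exact Set.indicator_nonneg (fun _ _ ↦ hM₀) _
    · rw [integral_indicator hSm, setIntegral_const, smul_eq_mul, mul_comm]
  set B := ∫ v in S, h⁻¹ * (F (‖v‖⁻¹ • v) * inner ℝ (‖v‖⁻¹ • v) z) ∂μ with hB
  -- on the annulus `v` is within `h` of `v / ‖v‖`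
  have hdir : ∀ v ∈ S, ‖‖v‖⁻¹ • v‖ = 1 := fun v hv ↦ by
    have : v ≠ 0 := by
      rintro rfl
      simp [hS] at hv
      linarith
    simp [norm_smul, this]
  have e₂ : |J - B| ≤ M * μ.real S := by
    obtain ⟨R, hR⟩ : ∃ R, ∀ v : E, ‖v‖ ≤ 1 → |F v| ≤ R := by
      refine ⟨|F 0| + K, fun v hv ↦ ?_⟩
      have h₃ := hF.dist_le_mul v 0
      rw [Real.dist_eq, dist_zero_right] at h₃
      have h₄ : (K : ℝ) * ‖v‖ ≤ K := mul_le_of_le_one_right K.2 hv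
      have h₅ := abs_add_le (F 0) (F v - F 0)
      rw [add_sub_cancel] at h₅
      linarith
    have hR₀ : 0 ≤ R := (abs_nonneg _).trans (hR 0 (by simp))
    have hinner : ∀ v ∈ S, |inner ℝ (‖v‖⁻¹ • v) z| ≤ ‖z‖ := fun v hv ↦ by
      simpa [hdir v hv] using abs_real_inner_le_norm (‖v‖⁻¹ • v) z
    have i₁ : IntegrableOn (fun v ↦ h⁻¹ * (F v * inner ℝ (‖v‖⁻¹ • v) z)) S μ := by
      refine Measure.integrableOn_of_bounded hSfin (M := h⁻¹ * (R * ‖z‖))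
        (by fun_prop) ?_
      refine (ae_restrict_mem hSm).mono fun v hv ↦ ?_
      have hv' : ‖v‖ ≤ 1 := by
        have := hv.1
        rw [mem_ball_zero_iff] at this
        exact this.le
      rw [norm_mul, norm_mul, Real.norm_of_nonneg (inv_pos.2 hh).le]
      gcongr
      exacts [hR v hv', hinner v hv]
    have i₂ : IntegrableOn (fun v ↦ h⁻¹ * (F (‖v‖⁻¹ • v) * inner ℝ (‖v‖⁻¹ • v) z)) S μ := by
      refine Measure.integrableOn_of_bounded hSfin (M := h⁻¹ * (R * ‖z‖))
        (by fun_prop) ?_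
      refine (ae_restrict_mem hSm).mono fun v hv ↦ ?_
      rw [norm_mul, norm_mul, Real.norm_of_nonneg (inv_pos.2 hh).le]
      gcongr
      exacts [hR _ (hdir v hv).le, hinner v hv]
    rw [hJ, integral_lineDeriv_mul_radialCutoff μ hF z hh hh₁, hB, ← integral_sub i₁ i₂]
    rw [← Real.norm_eq_abs]
    refine norm_setIntegral_le_of_norm_le_const hSfin.lt_top fun v hv ↦ ?_
    have h₃ : ‖F v - F (‖v‖⁻¹ • v)‖ ≤ K * h := by
      have h₄ := hF.dist_le_mul v (‖v‖⁻¹ • v)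
      have h₅ : dist v (‖v‖⁻¹ • v) ≤ h := by
        obtain ⟨hv₁, hv₂⟩ : ‖v‖ < 1 ∧ 1 - h ≤ ‖v‖ := by simpa [hS] using hv
        have hv₀ : 0 < ‖v‖ := by linarith
        have h₆ : v - ‖v‖⁻¹ • v = (1 - ‖v‖⁻¹) • v := by rw [sub_smul, one_smul]
        have h₇ : 1 ≤ ‖v‖⁻¹ := (one_le_inv₀ hv₀).2 hv₁.le
        rw [dist_eq_norm, h₆, norm_smul, Real.norm_of_nonpos (by linarith), neg_sub, sub_mul,
          inv_mul_cancel₀ hv₀.ne']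
        linarith
      exact h₄.trans (by gcongr)
    rw [← mul_sub, ← sub_mul, norm_mul, norm_mul, Real.norm_of_nonneg (inv_pos.2 hh).le]
    calc h⁻¹ * (‖F v - F (‖v‖⁻¹ • v)‖ * ‖inner ℝ (‖v‖⁻¹ • v) z‖)
        ≤ h⁻¹ * ((K * h) * ‖z‖) := by
          gcongr
          exact hinner v hv
      _ = M := by rw [hM]; field_simp
  have e₃ : |B - I| ≤ |I| * (1 - (1 - h) ^ (n - 1)) := by
    have h₃ : B = I * (h⁻¹ * ∫ r in Set.Ico (1 - h) 1, r ^ (n - 1)) := by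
      rw [hB, integral_const_mul,
        integral_annulus_direction μ (fun v ↦ F v * inner ℝ v z) hh₁]
      ring
    rw [h₃, ← mul_sub_one, abs_mul]
    exact mul_le_mul_of_nonneg_left (abs_inv_mul_setIntegral_pow_sub_one_le _ hh hh₁)
      (abs_nonneg _)
  rw [← hSV]
  have h₃ := abs_sub_le D J I
  have h₄ := abs_sub_le J B I
  linarith

end Divergence

/-! ### One-point gradient estimation for smooth convex losses -/

theorem ConvexOn.add_fderiv_sub_le {E : Type*} [NormedAddCommGroup E] [NormedSpace ℝ E]
    {D : Set E} {f : E → ℝ} (hf : ConvexOn ℝ D f) {p q : E} (hp : p ∈ D) (hq : q ∈ D)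
    (hd : DifferentiableAt ℝ f p) : f p + fderiv ℝ f p (q - p) ≤ f q := by
  have h₁ : HasDerivAt (fun t : ℝ ↦ f (p + t • (q - p))) (fderiv ℝ f p (q - p)) 0 :=
    hd.hasFDerivAt.hasLineDerivAt (q - p)
  have h₂ := h₁.tendsto_slope_zero_right
  suffices fderiv ℝ f p (q - p) ≤ f q - f p by linarith
  refine le_of_tendsto h₂ ?_
  filter_upwards [Ioo_mem_nhdsGT (zero_lt_one' ℝ)] with t ht
  have h₃ := hf.2 hp hq (sub_nonneg.2 ht.2.le) ht.1.le (sub_add_cancel 1 t)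
  have h₄ : (1 - t) • p + t • q = p + t • (q - p) := by module
  rw [h₄] at h₃
  simp only [zero_add, zero_smul, add_zero, smul_eq_mul] at h₃ ⊢
  rw [inv_mul_le_iff₀ ht.1]
  linarith

theorem setIntegral_ball_le_of_symm {E : Type*} [NormedAddCommGroup E] [NormedSpace ℝ E]
    [FiniteDimensional ℝ E] [MeasurableSpace E] [BorelSpace E] (μ : Measure E)
    [μ.IsAddHaarMeasure] {φ : E → ℝ} (hφ : Continuous φ) {a : ℝ}
    (h : ∀ v ∈ Metric.ball (0 : E) 1, φ v + φ (-v) ≤ 2 * a) :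
    ∫ v in Metric.ball (0 : E) 1, φ v ∂μ ≤ μ.real (Metric.ball (0 : E) 1) * a := by
  have hint : ∀ ψ : E → ℝ, Continuous ψ → IntegrableOn ψ (Metric.ball (0 : E) 1) μ :=
    fun ψ hψ ↦ (hψ.continuousOn.integrableOn_compact (isCompact_closedBall 0 1)).mono_set
      Metric.ball_subset_closedBall
  have h₁ : ∫ v in Metric.ball (0 : E) 1, φ (-v) ∂μ = ∫ v in Metric.ball (0 : E) 1, φ v ∂μ := by
    have := (Measure.measurePreserving_neg μ).setIntegral_preimage_emb
      (Homeomorph.neg E).measurableEmbedding φ (Metric.ball (0 : E) 1)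
    simpa using this
  have h₂ := setIntegral_mono_on ((hint φ hφ).add (hint (fun v ↦ φ (-v)) (by fun_prop)))
    (integrableOn_const (C := 2 * a) measure_ball_lt_top.ne) measurableSet_ball h
  rw [integral_add' (hint φ hφ) (hint (fun v ↦ φ (-v)) (by fun_prop)), h₁, setIntegral_const,
    smul_eq_mul] at h₂
  linarith

section Losses

variable {d : ℕ} {X : Set (Vec d)} {δ : ℝ}

theorem add_smul_mem_ballRegion {x v : Vec d} (hx : x ∈ X) (hv : ‖v‖ ≤ 1) :
    x + δ • v ∈ ballRegion X δ := ⟨x, hx, v, hv, rfl⟩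

theorem subset_ballRegion : X ⊆ ballRegion X δ := fun x hx ↦
  ⟨x, hx, 0, by simp, by simp⟩

theorem queryRegion_subset_ballRegion : queryRegion X δ ⊆ ballRegion X δ := by
  rintro z ⟨x, hx, v, hv, rfl⟩
  exact ⟨x, hx, v, hv.le, rfl⟩

theorem IsSmoothConvexLoss.exists_lipschitz_extension {D : Set (Vec d)} {L₀ L₁ : ℝ}
    {f : Vec d → ℝ} (hf : IsSmoothConvexLoss D L₀ L₁ f) :
    ∃ g : Vec d → ℝ, LipschitzWith L₀.toNNReal g ∧ Set.EqOn f g D := by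
  refine LipschitzOnWith.extend_real (LipschitzOnWith.of_dist_le_mul fun x hx y hy ↦ ?_)
  rw [Real.dist_eq, dist_eq_norm]
  exact (hf.lipschitz x hx y hy).trans
    (mul_le_mul_of_nonneg_right (Real.le_coe_toNNReal L₀) (norm_nonneg _))

theorem IsSmoothConvexLoss.two_mul_le_add {L₀ L₁ : ℝ} {f : Vec d → ℝ}
    (hf : IsSmoothConvexLoss (ballRegion X δ) L₀ L₁ f) {x v : Vec d} (hx : x ∈ X)
    (hv : ‖v‖ ≤ 1) : 2 * f x ≤ f (x + δ • v) + f (x + δ • -v) := by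
  have h₁ := hf.convex.2 (add_smul_mem_ballRegion (δ := δ) hx hv)
    (add_smul_mem_ballRegion (δ := δ) hx ((norm_neg v).trans_le hv))
    (by norm_num : (0 : ℝ) ≤ 1 / 2) (by norm_num : (0 : ℝ) ≤ 1 / 2) (by norm_num)
  have h₂ : (1 / 2 : ℝ) • (x + δ • v) + (1 / 2 : ℝ) • (x + δ • -v) = x := by module
  rw [h₂] at h₁
  simp only [smul_eq_mul] at h₁
  linarith

theorem IsSmoothConvexLoss.add_le_two_mul {L₀ L₁ : ℝ} {f : Vec d → ℝ} (hL₁ : 0 ≤ L₁)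
    (hδ : 0 ≤ δ) (hf : IsSmoothConvexLoss (ballRegion X δ) L₀ L₁ f) {x v : Vec d} (hx : x ∈ X)
    (hv : ‖v‖ ≤ 1) : f (x + δ • v) + f (x + δ • -v) ≤ 2 * (f x + L₁ * δ ^ 2) := by
  have hp := add_smul_mem_ballRegion (δ := δ) hx hv
  have hq := add_smul_mem_ballRegion (δ := δ) hx ((norm_neg v).trans_le hv)
  have hx' := subset_ballRegion (δ := δ) hx
  have hgrad : ∀ p ∈ ballRegion X δ, ∀ w, fderiv ℝ f p w = inner ℝ (gradient f p) w :=
    fun p _ w ↦ by simp [gradient]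
  have h₁ := hf.convex.add_fderiv_sub_le hp hx' (hf.differentiable _ hp)
  have h₂ := hf.convex.add_fderiv_sub_le hq hx' (hf.differentiable _ hq)
  rw [hgrad _ hp, show x - (x + δ • v) = -(δ • v) by abel, inner_neg_right] at h₁
  rw [hgrad _ hq, show x - (x + δ • -v) = δ • v by module] at h₂
  have h₃ := real_inner_le_norm (gradient f (x + δ • v) - gradient f (x + δ • -v)) (δ • v)
  rw [inner_sub_left] at h₃
  have h₄ := hf.smooth _ hp _ hq
  rw [show x + δ • v - (x + δ • -v) = (2 * δ) • v by module, norm_smul,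
    Real.norm_of_nonneg (by positivity)] at h₄
  have h₅ : ‖δ • v‖ ≤ δ := by
    rw [norm_smul, Real.norm_of_nonneg hδ]
    exact mul_le_of_le_one_right hδ hv
  have h₆ : L₁ * (2 * δ * ‖v‖) ≤ L₁ * (2 * δ) := by
    exact mul_le_mul_of_nonneg_left (mul_le_of_le_one_right (by positivity) hv) hL₁
  have h₇ := mul_le_mul (h₄.trans h₆) h₅ (norm_nonneg _) (by positivity)
  linarith

theorem integral_uniformSphere (hd : 0 < d) (φ : UnitSphere d → ℝ) :
    d * (volume : Measure (Vec d)).real (Metric.ball 0 1) * ∫ u, φ u ∂uniformSphere d =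
      ∫ u, φ u ∂(volume : Measure (Vec d)).toSphere := by
  have : Nontrivial (Vec d) := by
    have : Nonempty (Fin d) := ⟨⟨0, hd⟩⟩
    infer_instance
  have h₁ := (volume : Measure (Vec d)).toSphere_real_apply_univ
  have h₂ : (volume : Measure (Vec d)).toSphere.real Set.univ ≠ 0 := by
    exact (measureReal_ne_zero_iff).2 (Measure.measure_univ_ne_zero.2 (Measure.toSphere_ne_zero _))
  rw [finrank_euclideanSpace, Fintype.card_fin] at h₁
  rw [uniformSphere, integral_smul_measure, ENNReal.toReal_inv, ← measureReal_def, ← h₁,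
    smul_eq_mul, mul_inv_cancel_left₀ h₂]

/-- The one-point gradient estimate along a uniform direction `u`, paired with `x - y`, dominates
`f x - f y` in expectation, up to a second-order smoothing error.  By the divergence theorem the
expectation is the average of the directional derivative over the ball, which convexity bounds from
below by an average of `f (x + δ v) - f (y + δ v)`.  The constant `c` is irrelevant, because `u` is
centred. -/
theorem IsSmoothConvexLoss.sub_le_integral_estimator (hd : 0 < d) {L₀ L₁ : ℝ} {f : Vec d → ℝ}
    (hL₁ : 0 ≤ L₁) (hδ : 0 < δ) (hf : IsSmoothConvexLoss (ballRegion X δ) L₀ L₁ f)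
    {x y : Vec d} (hx : x ∈ X) (hy : y ∈ X) (c : ℝ) :
    f x - f y - L₁ * δ ^ 2 ≤
      ∫ u, d / δ * (f (x + δ • (u : Vec d)) - c) * inner ℝ (u : Vec d) (x - y)
        ∂uniformSphere d := by
  have : Nontrivial (Vec d) := by
    have : Nonempty (Fin d) := ⟨⟨0, hd⟩⟩
    infer_instance
  obtain ⟨g, hg, hfg⟩ := hf.exists_lipschitz_extension
  set V := (volume : Measure (Vec d)).real (Metric.ball 0 1) with hV
  have hV₀ : 0 < V := by
    rw [hV, measureReal_def, ENNReal.toReal_pos_iff]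
    exact ⟨Metric.measure_ball_pos _ _ one_pos, measure_ball_lt_top⟩
  have hgc := hg.continuous
  have hF : LipschitzWith (L₀.toNNReal * Real.nnabs δ) fun v ↦ g (x + δ • v) - c := by
    refine LipschitzWith.of_dist_le_mul fun v w ↦ ?_
    rw [dist_sub_right]
    refine (hg.dist_le_mul _ _).trans_eq ?_
    rw [dist_add_left, dist_smul₀]
    push_cast
    rw [mul_assoc]
    rfl
  have hdiv := setIntegral_ball_lineDeriv (volume : Measure (Vec d)) hF (x - y)
  rw [← integral_uniformSphere hd] at hdiv
  have hsphere : ∀ u : UnitSphere d,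
      d / δ * (f (x + δ • (u : Vec d)) - c) * inner ℝ (u : Vec d) (x - y) =
        d / δ * ((g (x + δ • (u : Vec d)) - c) * inner ℝ (u : Vec d) (x - y)) := fun u ↦ by
    rw [hfg (add_smul_mem_ballRegion hx (norm_eq_of_mem_sphere u).le), mul_assoc]
  simp_rw [hsphere]
  rw [integral_const_mul]
  have hball : ∀ v ∈ Metric.ball (0 : Vec d) 1, δ * (g (x + δ • v) - g (y + δ • v)) ≤
      lineDeriv ℝ (fun v ↦ g (x + δ • v) - c) v (x - y) := fun v hv ↦ by
    have hv' : ‖v‖ ≤ 1 := (mem_ball_zero_iff.1 hv).le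
    have hp := add_smul_mem_ballRegion (δ := δ) hx hv'
    have hq := add_smul_mem_ballRegion (δ := δ) hy hv'
    have h₁ : (fun v ↦ g (x + δ • v) - c) =ᶠ[nhds v] fun v ↦ f (x + δ • v) - c := by
      filter_upwards [Metric.isOpen_ball.mem_nhds hv] with w hw
      rw [hfg (add_smul_mem_ballRegion hx (mem_ball_zero_iff.1 hw).le)]
    have h₂ : HasFDerivAt (fun v : Vec d ↦ x + δ • v) (δ • ContinuousLinearMap.id ℝ (Vec d)) v :=
      ((hasFDerivAt_id v).const_smul δ).const_add x
    have h₃ := (((hf.differentiable _ hp).hasFDerivAt.comp v h₂).sub_const c).hasLineDerivAt (x - y)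
    have h₄ := hf.convex.add_fderiv_sub_le hp hq (hf.differentiable _ hp)
    rw [show y + δ • v - (x + δ • v) = -(x - y) by abel, map_neg] at h₄
    rw [h₁.lineDeriv_eq, ← hfg hp, ← hfg hq]
    refine le_trans ?_ h₃.lineDeriv.ge
    simp only [ContinuousLinearMap.comp_smul, ContinuousLinearMap.comp_id,
      smul_apply, smul_eq_mul]
    gcongr
    linarith
  have hint : ∀ ψ : Vec d → ℝ, Continuous ψ → IntegrableOn ψ (Metric.ball (0 : Vec d) 1) :=
    fun ψ hψ ↦ (hψ.continuousOn.integrableOn_compact (isCompact_closedBall 0 1)).mono_set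
      Metric.ball_subset_closedBall
  have hmono := setIntegral_mono_on (hint (fun v ↦ δ * (g (x + δ • v) - g (y + δ • v)))
    (by fun_prop)) (Measure.integrableOn_of_bounded measure_ball_lt_top.ne
      (measurable_lineDeriv hF.continuous).aestronglyMeasurable
      (.of_forall fun v ↦ norm_lineDeriv_le_of_lipschitz ℝ hF)) measurableSet_ball hball
  rw [hdiv, integral_const_mul, integral_sub (hint _ (by fun_prop)) (hint _ (by fun_prop))]
    at hmono
  have hlow := setIntegral_ball_le_of_symm (volume : Measure (Vec d))
    (φ := fun v ↦ -g (x + δ • v)) (by fun_prop) (a := -f x) fun v hv ↦ by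
      have hv' : ‖v‖ ≤ 1 := (mem_ball_zero_iff.1 hv).le
      have h₁ := hf.two_mul_le_add hx hv'
      rw [hfg (add_smul_mem_ballRegion hx hv'),
        hfg (add_smul_mem_ballRegion hx ((norm_neg v).trans_le hv'))] at h₁
      linarith
  have hupp := setIntegral_ball_le_of_symm (volume : Measure (Vec d))
    (φ := fun v ↦ g (y + δ • v)) (by fun_prop) (a := f y + L₁ * δ ^ 2) fun v hv ↦ by
      have hv' : ‖v‖ ≤ 1 := (mem_ball_zero_iff.1 hv).le
      have h₁ := hf.add_le_two_mul hL₁ hδ.le hy hv'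
      rwa [hfg (add_smul_mem_ballRegion hy hv'),
        hfg (add_smul_mem_ballRegion hy ((norm_neg v).trans_le hv'))] at h₁
  rw [integral_neg] at hlow
  set Q := ∫ u : UnitSphere d, (g (x + δ • (u : Vec d)) - c) * inner ℝ (u : Vec d) (x - y)
    ∂uniformSphere d
  have h₁ : δ * (V * (f x - f y - L₁ * δ ^ 2)) ≤ d * V * Q := by
    refine le_trans ?_ hmono
    gcongr
    linarith
  rw [div_mul_eq_mul_div, le_div_iff₀ hδ]
  refine le_of_mul_le_mul_left ?_ hV₀
  linarith

end Losses

/-! ### Projections and averaging over the network -/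

section Projection

variable {d : ℕ} {X : Set (Vec d)}

theorem IsProjection.inner_le_zero (hX : Convex ℝ X) {q p z : Vec d} (h : IsProjection X q p)
    (hz : z ∈ X) : inner ℝ (q - p) (z - p) ≤ 0 := by
  refine (norm_eq_iInf_iff_real_inner_le_zero hX h.1).1 (le_antisymm ?_ ?_) z hz
  · have : Nonempty X := ⟨⟨p, h.1⟩⟩
    exact le_ciInf fun w ↦ h.2 w w.2
  · exact ciInf_le (f := fun w : X ↦ ‖q - w‖)
      ⟨0, by rintro _ ⟨w, rfl⟩; exact norm_nonneg _⟩ ⟨p, h.1⟩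

theorem IsProjection.norm_sub_le (hX : Convex ℝ X) {q q' p p' : Vec d}
    (h : IsProjection X q p) (h' : IsProjection X q' p') : ‖p - p'‖ ≤ ‖q - q'‖ := by
  have h₁ := h.inner_le_zero hX h'.1
  have h₂ := h'.inner_le_zero hX h.1
  have h₃ : ‖p - p'‖ ^ 2 ≤ inner ℝ (q - q') (p - p') := by
    rw [← real_inner_self_eq_norm_sq]
    have h₄ : inner ℝ (q - p) (p' - p) = -inner ℝ (q - p) (p - p') := by
      rw [← neg_sub p p', inner_neg_right]
    have h₅ : inner ℝ (q - q') (p - p') =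
        inner ℝ (q - p) (p - p') + inner ℝ (p - p') (p - p') - inner ℝ (q' - p') (p - p') := by
      simp only [inner_sub_left]
      ring
    linarith
  have h₆ := h₃.trans (real_inner_le_norm _ _)
  rw [pow_two] at h₆
  by_contra! hlt
  have h₇ : 0 < ‖p - p'‖ := (norm_nonneg _).trans_lt hlt
  exact absurd h₆ (not_le.2 (by gcongr))

theorem IsProjection.unique (hX : Convex ℝ X) {q p p' : Vec d} (h : IsProjection X q p)
    (h' : IsProjection X q p') : p = p' := by
  have h₁ := h.norm_sub_le hX h'
  rw [sub_self, norm_zero] at h₁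
  exact sub_eq_zero.1 (norm_le_zero_iff.1 h₁)

theorem isProjection_self {z : Vec d} (hz : z ∈ X) : IsProjection X z z :=
  ⟨hz, fun w _ ↦ by simp⟩

theorem exists_isProjection (hX : IsClosed X) (hXc : Convex ℝ X) (hne : X.Nonempty) :
    ∃ P : Vec d → Vec d, (∀ q, IsProjection X q (P q)) ∧ LipschitzWith 1 P := by
  have h : ∀ q : Vec d, ∃ p, IsProjection X q p := fun q ↦ by
    obtain ⟨p, hp, hmin⟩ := exists_norm_eq_iInf_of_complete_convex hne hX.isComplete hXc q
    refine ⟨p, hp, fun z hz ↦ hmin.le.trans ?_⟩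
    exact ciInf_le (f := fun w : X ↦ ‖q - w‖)
      ⟨0, by rintro _ ⟨w, rfl⟩; exact norm_nonneg _⟩ ⟨z, hz⟩
  choose P hP using h
  refine ⟨P, hP, LipschitzWith.of_dist_le_mul fun q q' ↦ ?_⟩
  simpa [dist_eq_norm] using (hP q).norm_sub_le hXc (hP q')

end Projection

/-- The bias-variance decomposition of a weighted mean. -/
theorem norm_sq_weighted_mean_sub_add {E ι : Type*} [NormedAddCommGroup E]
    [InnerProductSpace ℝ E] [Fintype ι] {a : ι → ℝ} (ha : ∑ j, a j = 1) (w : ι → E) (y : E) :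
    ‖∑ j, a j • w j - y‖ ^ 2 + ∑ j, a j * ‖w j - ∑ k, a k • w k‖ ^ 2 =
      ∑ j, a j * ‖w j - y‖ ^ 2 := by
  set m := ∑ j, a j • w j with hm
  have h₁ : ∀ j, ‖w j - y‖ ^ 2 = ‖w j - m‖ ^ 2 + 2 * inner ℝ (w j - m) (m - y) + ‖m - y‖ ^ 2 :=
    fun j ↦ by rw [← norm_add_sq_real, sub_add_sub_cancel]
  have h₂ : ∑ j, a j * inner ℝ (w j - m) (m - y) = 0 := by
    simp_rw [← real_inner_smul_left]
    rw [← sum_inner]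
    simp_rw [smul_sub]
    rw [Finset.sum_sub_distrib, ← Finset.sum_smul, ha, one_smul, ← hm, sub_self, inner_zero_left]
  have h₃ : ∀ j, a j * ‖w j - y‖ ^ 2 = a j * ‖w j - m‖ ^ 2 +
      2 * (a j * inner ℝ (w j - m) (m - y)) + a j * ‖m - y‖ ^ 2 := fun j ↦ by
    rw [h₁]
    ring
  simp_rw [h₃]
  rw [Finset.sum_add_distrib, Finset.sum_add_distrib, ← Finset.mul_sum, ← Finset.sum_mul, ha, h₂]
  ring

section Network

variable {d N : ℕ} {X : Set (Vec d)} {G : SimpleGraph (Fin N)} {A : Matrix (Fin N) (Fin N) ℝ}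
  {ε : ℝ}

/-- Averaging over the network dissipates at least `ε` times the squared displacement it causes:
each agent keeps a share of more than `ε` of its own value.  Connectivity of the graph plays no
role. -/
theorem IsNetworkMatrix.sum_norm_sq_average_sub_add_le (hA : IsNetworkMatrix G A ε)
    (w : Fin N → Vec d) (y : Vec d) :
    ∑ i, ‖∑ j, A i j • w j - y‖ ^ 2 + ε * ∑ i, ‖w i - ∑ j, A i j • w j‖ ^ 2 ≤
      ∑ i, ‖w i - y‖ ^ 2 := by
  obtain ⟨hnn, hrow, hcol⟩ := mem_doublyStochastic_iff_sum.1 hA.stochastic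
  have h₁ : ∑ i, ∑ j, A i j * ‖w j - y‖ ^ 2 = ∑ i, ‖w i - y‖ ^ 2 := by
    rw [Finset.sum_comm]
    simp_rw [← Finset.sum_mul, hcol, one_mul]
  rw [← h₁, Finset.mul_sum, ← Finset.sum_add_distrib]
  refine Finset.sum_le_sum fun i _ ↦ ?_
  rw [← norm_sq_weighted_mean_sub_add (hrow i) w y]
  gcongr
  calc ε * ‖w i - ∑ j, A i j • w j‖ ^ 2 ≤ A i i * ‖w i - ∑ j, A i j • w j‖ ^ 2 := by
        gcongr
        exact (hA.self_weight i).le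
    _ ≤ _ := Finset.single_le_sum (f := fun j ↦ A i j * ‖w j - ∑ k, A i k • w k‖ ^ 2)
        (fun j _ ↦ mul_nonneg (hnn i j) (by positivity)) (Finset.mem_univ i)

/-- One round of distributed projected descent.  The squared displacements on the left come for
free from the dissipation of the averaging step. -/
theorem IsNetworkMatrix.sum_norm_sq_step_le (hA : IsNetworkMatrix G A ε) (hε₀ : 0 ≤ ε)
    (hε₁ : ε ≤ 1) (hX : Convex ℝ X) {η : ℝ} {x g x' : Fin N → Vec d} (hx : ∀ i, x i ∈ X)
    (hx' : ∀ i, IsProjection X (∑ j, A i j • (x j - η • g j)) (x' i)) {y : Vec d} (hy : y ∈ X) :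
    ∑ i, ‖x' i - y‖ ^ 2 + ε / 2 * ∑ i, ‖x' i - x i‖ ^ 2 + 2 * η * ∑ i, inner ℝ (g i) (x i - y) ≤
      ∑ i, ‖x i - y‖ ^ 2 + 2 * η ^ 2 * ∑ i, ‖g i‖ ^ 2 := by
  have h₁ := hA.sum_norm_sq_average_sub_add_le (fun j ↦ x j - η • g j) y
  set m : Fin N → Vec d := fun i ↦ ∑ j, A i j • (x j - η • g j) with hm
  have h₂ : ∑ i, ‖x' i - y‖ ^ 2 ≤ ∑ i, ‖m i - y‖ ^ 2 := Finset.sum_le_sum fun i _ ↦ by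
    gcongr
    exact (hx' i).norm_sub_le hX (isProjection_self hy)
  have h₃ : ∑ i, ‖x' i - x i‖ ^ 2 ≤
      2 * ∑ i, ‖x i - η • g i - m i‖ ^ 2 + 2 * η ^ 2 * ∑ i, ‖g i‖ ^ 2 := by
    rw [Finset.mul_sum, Finset.mul_sum, ← Finset.sum_add_distrib]
    refine Finset.sum_le_sum fun i _ ↦ ?_
    have h₄ : ‖x' i - x i‖ ≤ ‖x i - η • g i - m i‖ + ‖η • g i‖ := by
      refine ((hx' i).norm_sub_le hX (isProjection_self (hx i))).trans ?_
      rw [norm_sub_rev]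
      refine le_trans (le_of_eq ?_) (norm_add_le _ _)
      congr 1
      simp only [hm]
      abel
    have h₅ : ‖η • g i‖ ^ 2 = η ^ 2 * ‖g i‖ ^ 2 := by
      rw [norm_smul, mul_pow, Real.norm_eq_abs, sq_abs]
    have h₆ := pow_le_pow_left₀ (norm_nonneg _) h₄ 2
    nlinarith [sq_nonneg (‖x i - η • g i - m i‖ - ‖η • g i‖)]
  have h₄ : ∑ i, ‖x i - η • g i - y‖ ^ 2 = ∑ i, ‖x i - y‖ ^ 2 -
      2 * η * ∑ i, inner ℝ (g i) (x i - y) + η ^ 2 * ∑ i, ‖g i‖ ^ 2 := by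
    rw [Finset.mul_sum, Finset.mul_sum, ← Finset.sum_sub_distrib, ← Finset.sum_add_distrib]
    refine Finset.sum_congr rfl fun i _ ↦ ?_
    rw [show x i - η • g i - y = (x i - y) - η • g i by abel, norm_sub_sq_real,
      real_inner_smul_right, real_inner_comm, norm_smul, mul_pow, Real.norm_eq_abs, sq_abs]
    ring
  have h₅ : 0 ≤ η ^ 2 * ∑ i, ‖g i‖ ^ 2 := by positivity
  have h₆ := mul_le_mul_of_nonneg_left h₃ (by positivity : 0 ≤ ε / 2)
  have h₇ := mul_le_mul_of_nonneg_right hε₁ h₅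
  rw [h₄] at h₁
  nlinarith

end Network

/-! ### The pathwise regret inequality -/

section Pathwise

variable {d N : ℕ} {X : Set (Vec d)} {G : SimpleGraph (Fin N)} {A : Matrix (Fin N) (Fin N) ℝ}
  {ε η δ L₀ L₁ r : ℝ} {T : ℕ} {f : ℤ → Fin N → Vec d → ℝ}

theorem norm_le_of_mem_ballRegion (hδ : 0 ≤ δ) (hr : X ⊆ Metric.closedBall 0 r) {z : Vec d}
    (hz : z ∈ ballRegion X δ) : ‖z‖ ≤ r + δ := by
  obtain ⟨x, hx, v, hv, rfl⟩ := hz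
  refine (norm_add_le _ _).trans (add_le_add (mem_closedBall_zero_iff.1 (hr hx)) ?_)
  rw [norm_smul, Real.norm_of_nonneg hδ]
  exact mul_le_of_le_one_right hδ hv

theorem IsSmoothConvexLoss.abs_le {g : Vec d → ℝ} (hL₀ : 0 ≤ L₀) (hδ : 0 ≤ δ)
    (hg : IsSmoothConvexLoss (ballRegion X δ) L₀ L₁ g) (h₀ : 0 ∈ X)
    (hr : X ⊆ Metric.closedBall 0 r) {z : Vec d} (hz : z ∈ ballRegion X δ) :
    |g z| ≤ |g 0| + L₀ * (r + δ) := by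
  have h₁ := hg.lipschitz z hz 0 (subset_ballRegion h₀)
  rw [sub_zero] at h₁
  have h₂ := mul_le_mul_of_nonneg_left (norm_le_of_mem_ballRegion hδ hr hz) hL₀
  have h₃ := abs_add_le (g z - g 0) (g 0)
  rw [sub_add_cancel] at h₃
  linarith

theorem abs_sub_le_increasingRate (hL₀ : 0 ≤ L₀) (hδ : 0 ≤ δ) (h₀ : 0 ∈ X)
    (hr : X ⊆ Metric.closedBall 0 r) {t : ℤ} {i : Fin N}
    (hf : IsSmoothConvexLoss (ballRegion X δ) L₀ L₁ (f t i))
    (hf' : IsSmoothConvexLoss (ballRegion X δ) L₀ L₁ (f (t - 1) i)) {z : Vec d}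
    (hz : z ∈ queryRegion X δ) : |f t i z - f (t - 1) i z| ≤ increasingRate X δ f t i := by
  refine le_csSup ⟨|f t i 0| + L₀ * (r + δ) + (|f (t - 1) i 0| + L₀ * (r + δ)), ?_⟩
    (Set.mem_image_of_mem _ hz)
  rintro _ ⟨w, hw, rfl⟩
  have hw' := queryRegion_subset_ballRegion hw
  exact (abs_sub _ _).trans
    (add_le_add (hf.abs_le hL₀ hδ h₀ hr hw') (hf'.abs_le hL₀ hδ h₀ hr hw'))

/-- Residual feedback: the estimator is bounded by the drift of the losses, by the last
displacement, and by a term that does not grow as `δ` shrinks. -/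
theorem norm_sq_orfEstimator_le (hL₀ : 0 ≤ L₀) (hδ : 0 < δ) (h₀ : 0 ∈ X)
    (hr : X ⊆ Metric.closedBall 0 r) {t : ℤ} {i : Fin N}
    (hf : IsSmoothConvexLoss (ballRegion X δ) L₀ L₁ (f t i))
    (hf' : IsSmoothConvexLoss (ballRegion X δ) L₀ L₁ (f (t - 1) i))
    (u : ℤ → Fin N → UnitSphere d) {x : ℤ → Fin N → Vec d} (hx : x t i ∈ X)
    (hx' : x (t - 1) i ∈ X) :
    ‖orfEstimator δ f u x t i‖ ^ 2 ≤ 3 * d ^ 2 / δ ^ 2 * (increasingRate X δ f t i ^ 2 +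
      L₀ ^ 2 * ‖x t i - x (t - 1) i‖ ^ 2 + 4 * δ ^ 2 * L₀ ^ 2) := by
  have hu : ∀ s, ‖(u s i : Vec d)‖ = 1 := fun s ↦ norm_eq_of_mem_sphere _
  set z := x t i + δ • (u t i : Vec d)
  set z' := x (t - 1) i + δ • (u (t - 1) i : Vec d)
  have hz : z ∈ queryRegion X δ := ⟨_, hx, _, hu t, rfl⟩
  have hz' : z' ∈ queryRegion X δ := ⟨_, hx', _, hu (t - 1), rfl⟩
  have h₁ := abs_sub_le_increasingRate hL₀ hδ.le h₀ hr hf hf' hz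
  have h₂ := hf'.lipschitz z (queryRegion_subset_ballRegion hz) z'
    (queryRegion_subset_ballRegion hz')
  have h₃ : ‖z - z'‖ ≤ ‖x t i - x (t - 1) i‖ + 2 * δ := by
    rw [show z - z' = (x t i - x (t - 1) i) + δ • ((u t i : Vec d) - u (t - 1) i) by
      simp only [z, z']; module]
    refine (norm_add_le _ _).trans (add_le_add le_rfl ?_)
    have h₄ := norm_sub_le (u t i : Vec d) (u (t - 1) i)
    rw [hu, hu] at h₄
    rw [norm_smul, Real.norm_of_nonneg hδ.le]
    nlinarith
  have h₄ : |f t i z - f (t - 1) i z'| ≤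
      increasingRate X δ f t i + L₀ * ‖x t i - x (t - 1) i‖ + 2 * δ * L₀ := by
    have h₅ := abs_sub_le (f t i z) (f (t - 1) i z) (f (t - 1) i z')
    have h₆ := mul_le_mul_of_nonneg_left h₃ hL₀
    linarith
  have h₅ := pow_le_pow_left₀ (abs_nonneg _) h₄ 2
  rw [sq_abs] at h₅
  have h₆ : ‖orfEstimator δ f u x t i‖ ^ 2 =
      d ^ 2 / δ ^ 2 * (f t i z - f (t - 1) i z') ^ 2 := by
    rw [orfEstimator, norm_smul, hu, mul_one, Real.norm_eq_abs, sq_abs, mul_pow, div_pow]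
  rw [h₆, show (3 : ℝ) * d ^ 2 / δ ^ 2 = d ^ 2 / δ ^ 2 * 3 by ring, mul_assoc]
  gcongr
  nlinarith [sq_nonneg (increasingRate X δ f t i - L₀ * ‖x t i - x (t - 1) i‖),
    sq_nonneg (increasingRate X δ f t i - 2 * δ * L₀),
    sq_nonneg (L₀ * ‖x t i - x (t - 1) i‖ - 2 * δ * L₀)]

theorem IsORFRun.mem {xₚ x₀ : Fin N → Vec d} {u : ℤ → Fin N → UnitSphere d}
    {x : ℤ → Fin N → Vec d} (hrun : IsORFRun X A η δ T f xₚ x₀ u x) (hp : ∀ i, xₚ i ∈ X)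
    (h₀ : ∀ i, x₀ i ∈ X) {t : ℤ} (ht : -1 ≤ t) (ht' : t ≤ T + 1) (i : Fin N) : x t i ∈ X := by
  rcases ht.eq_or_lt with rfl | ht
  · rw [hrun.previous]
    exact hp i
  rcases (show 0 ≤ t by omega).eq_or_lt with rfl | ht
  · rw [hrun.start]
    exact h₀ i
  have := (hrun.step (t - 1) (by omega) (by omega) i).1
  rwa [sub_add_cancel] at this

theorem Finset.Icc_one_intCast_succ (T : ℕ) :
    Finset.Icc (1 : ℤ) ((T + 1 : ℕ) : ℤ) = insert ((T : ℤ) + 1) (Finset.Icc (1 : ℤ) T) := by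
  ext t
  simp only [Finset.mem_Icc, Finset.mem_insert, Nat.cast_add, Nat.cast_one]
  omega

theorem sum_Icc_le_of_potential {a b c : ℤ → ℝ} (T : ℕ)
    (h : ∀ t : ℤ, 1 ≤ t → t ≤ T → a (t + 1) + b t ≤ a t + c t) :
    a (T + 1) + ∑ t ∈ Finset.Icc (1 : ℤ) T, b t ≤ a 1 + ∑ t ∈ Finset.Icc (1 : ℤ) T, c t := by
  induction T with
  | zero => simp
  | succ T ih =>
    have h₁ := ih fun t ht ht' ↦ h t ht (by push_cast; omega)
    have h₂ := h (T + 1) (by omega) (by push_cast; omega)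
    rw [Finset.Icc_one_intCast_succ, Finset.sum_insert (by simp), Finset.sum_insert (by simp)]
    push_cast
    linarith

/-- The regret inequality along a fixed realization.  The potential is
`∑ ‖x t - y‖² + ε / 2 * ∑ ‖x t - x (t - 1)‖²`: the displacement part of the estimator's norm is
absorbed by the dissipation of the averaging step as soon as the step size satisfies `hη`. -/
theorem IsORFRun.sum_inner_orfEstimator_le (hA : IsNetworkMatrix G A ε) (hε₀ : 0 ≤ ε)
    (hε₁ : ε ≤ 1) (hX : Convex ℝ X) (hL₀ : 0 ≤ L₀) (hδ : 0 < δ) (h₀ : 0 ∈ X)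
    (hr : X ⊆ Metric.closedBall 0 r)
    (hη : 2 * (3 * d ^ 2 * η ^ 2 / δ ^ 2) * L₀ ^ 2 ≤ ε / 2)
    (hf : ∀ t : ℤ, -1 ≤ t → t ≤ T → ∀ i, IsSmoothConvexLoss (ballRegion X δ) L₀ L₁ (f t i))
    {xₚ x₀ : Fin N → Vec d} (hxₚ : ∀ i, xₚ i ∈ X) (hx₀ : ∀ i, x₀ i ∈ X)
    {u : ℤ → Fin N → UnitSphere d} {x : ℤ → Fin N → Vec d}
    (hrun : IsORFRun X A η δ T f xₚ x₀ u x) {y : Vec d} (hy : y ∈ X) :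
    2 * η * ∑ t ∈ Finset.Icc (1 : ℤ) T, ∑ i, inner ℝ (orfEstimator δ f u x t i) (x t i - y) ≤
      8 * N * r ^ 2 + 2 * (3 * d ^ 2 * η ^ 2 / δ ^ 2) * accumulatedRate X δ T f ^ 2 +
        24 * d ^ 2 * η ^ 2 * L₀ ^ 2 * N * T := by
  set K := 3 * d ^ 2 * η ^ 2 / δ ^ 2 with hK
  have hK₀ : 0 ≤ K := by positivity
  have hmem : ∀ t : ℤ, -1 ≤ t → t ≤ T + 1 → ∀ i, x t i ∈ X := fun t ht ht' ↦
    hrun.mem hxₚ hx₀ ht ht'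
  have hpot := sum_Icc_le_of_potential
    (a := fun t ↦ ∑ i, ‖x t i - y‖ ^ 2 + ε / 2 * ∑ i, ‖x t i - x (t - 1) i‖ ^ 2)
    (b := fun t ↦ 2 * η * ∑ i, inner ℝ (orfEstimator δ f u x t i) (x t i - y))
    (c := fun t ↦ 2 * K * ∑ i, increasingRate X δ f t i ^ 2 + 24 * d ^ 2 * η ^ 2 * L₀ ^ 2 * N)
    T fun t ht ht' ↦ by
      have h₁ := hA.sum_norm_sq_step_le hε₀ hε₁ hX (hmem t (by omega) (by omega))
        (hrun.step t (by omega) ht') hy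
      have h₂ : η ^ 2 * ∑ i, ‖orfEstimator δ f u x t i‖ ^ 2 ≤
          K * ∑ i, increasingRate X δ f t i ^ 2 +
            K * L₀ ^ 2 * ∑ i, ‖x t i - x (t - 1) i‖ ^ 2 + 12 * d ^ 2 * η ^ 2 * L₀ ^ 2 * N := by
        have h₃ : (12 * d ^ 2 * η ^ 2 * L₀ ^ 2 * N : ℝ) =
            ∑ _i : Fin N, 12 * (d : ℝ) ^ 2 * η ^ 2 * L₀ ^ 2 := by
          simp
          ring
        rw [h₃, Finset.mul_sum, Finset.mul_sum, Finset.mul_sum, ← Finset.sum_add_distrib,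
          ← Finset.sum_add_distrib]
        refine Finset.sum_le_sum fun i _ ↦ ?_
        have h₄ := mul_le_mul_of_nonneg_left (norm_sq_orfEstimator_le hL₀ hδ h₀ hr
          (hf t (by omega) ht' i) (hf (t - 1) (by omega) (by omega) i) u
          (hmem t (by omega) (by omega) i) (hmem (t - 1) (by omega) (by omega) i)) (sq_nonneg η)
        refine h₄.trans_eq ?_
        rw [hK]
        field_simp
        ring
      have h₃ : 2 * (K * L₀ ^ 2 * ∑ i, ‖x t i - x (t - 1) i‖ ^ 2) ≤
          ε / 2 * ∑ i, ‖x t i - x (t - 1) i‖ ^ 2 := by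
        have := mul_le_mul_of_nonneg_right hη
          (by positivity : 0 ≤ ∑ i, ‖x t i - x (t - 1) i‖ ^ 2)
        linarith
      simp only [add_sub_cancel_right]
      linarith
  have hdiam : ∀ p ∈ X, ∀ q ∈ X, ‖p - q‖ ^ 2 ≤ 4 * r ^ 2 := fun p hp q hq ↦ by
    have h₁ := norm_sub_le p q
    have h₂ := mem_closedBall_zero_iff.1 (hr hp)
    have h₃ := mem_closedBall_zero_iff.1 (hr hq)
    nlinarith [norm_nonneg (p - q), norm_nonneg p]
  have hinit : ∑ i, ‖x 1 i - y‖ ^ 2 + ε / 2 * ∑ i, ‖x 1 i - x (1 - 1) i‖ ^ 2 ≤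
      8 * N * r ^ 2 := by
    have h₁ : ∑ i, ‖x 1 i - y‖ ^ 2 ≤ N * (4 * r ^ 2) := by
      refine (Finset.sum_le_card_nsmul _ _ _ fun i _ ↦
        hdiam _ (hmem 1 (by omega) (by omega) i) y hy).trans_eq (by simp)
    have h₂ : ∑ i, ‖x 1 i - x (1 - 1) i‖ ^ 2 ≤ N * (4 * r ^ 2) := by
      refine (Finset.sum_le_card_nsmul _ _ _ fun i _ ↦
        hdiam _ (hmem 1 (by omega) (by omega) i) _ (hmem (1 - 1) (by omega) (by omega) i)).trans_eq
          (by simp)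
    have h₃ : ε / 2 * ∑ i, ‖x 1 i - x (1 - 1) i‖ ^ 2 ≤ 1 * (N * (4 * r ^ 2)) := by
      gcongr
      linarith
    linarith
  have hrate : ∑ t ∈ Finset.Icc (1 : ℤ) T, ∑ i, increasingRate X δ f t i ^ 2 ≤
      accumulatedRate X δ T f ^ 2 := by
    have hnn : ∀ t i, 0 ≤ increasingRate X δ f t i := fun t i ↦
      Real.sSup_nonneg (by rintro _ ⟨w, _, rfl⟩; exact abs_nonneg _)
    rw [accumulatedRate]
    refine le_trans (Finset.sum_le_sum fun t _ ↦ ?_)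
      (Finset.sum_sq_le_sq_sum_of_nonneg fun t _ ↦ Finset.sum_nonneg fun i _ ↦ hnn t i)
    exact Finset.sum_sq_le_sq_sum_of_nonneg fun i _ ↦ hnn t i
  have hend : 0 ≤ ∑ i, ‖x (T + 1) i - y‖ ^ 2 +
      ε / 2 * ∑ i, ‖x (T + 1) i - x (T + 1 - 1) i‖ ^ 2 := by positivity
  have hrate' := mul_le_mul_of_nonneg_left hrate (by positivity : 0 ≤ 2 * K)
  rw [← Finset.mul_sum, Finset.sum_add_distrib, ← Finset.mul_sum] at hpot
  simp only [Finset.sum_const, Int.card_Icc, nsmul_eq_mul, add_sub_cancel_right,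
    Int.toNat_natCast] at hpot hend
  linarith

end Pathwise

/-! ### Adaptedness and the conditional estimate -/

section Measurability

variable {d N : ℕ} {X : Set (Vec d)} {A : Matrix (Fin N) (Fin N) ℝ} {η δ L₀ L₁ : ℝ} {T : ℕ}
  {f : ℤ → Fin N → Vec d → ℝ} {Ω : Type*}

theorem IsSmoothConvexLoss.measurable_comp [MeasurableSpace Ω] {D : Set (Vec d)} {g : Vec d → ℝ}
    (hg : IsSmoothConvexLoss D L₀ L₁ g) {z : Ω → Vec d} (hz : Measurable z)
    (hzD : ∀ ω, z ω ∈ D) : Measurable fun ω ↦ g (z ω) := by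
  obtain ⟨k, hk, hgk⟩ := hg.exists_lipschitz_extension
  have h₁ : (fun ω ↦ g (z ω)) = fun ω ↦ k (z ω) := funext fun ω ↦ hgk (hzD ω)
  rw [h₁]
  exact hk.continuous.measurable.comp hz

theorem measurable_query_loss [MeasurableSpace Ω] {g : Vec d → ℝ}
    (hg : IsSmoothConvexLoss (ballRegion X δ) L₀ L₁ g) {x : Ω → Vec d} {u : Ω → UnitSphere d}
    (hx : Measurable x) (hu : Measurable u) (hxX : ∀ ω, x ω ∈ X) :
    Measurable fun ω ↦ g (x ω + δ • (u ω : Vec d)) :=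
  hg.measurable_comp (hx.add ((measurable_subtype_coe.comp hu).const_smul δ)) fun ω ↦
    add_smul_mem_ballRegion (hxX ω) (norm_eq_of_mem_sphere (u ω)).le

theorem measurable_orf_step [MeasurableSpace Ω] (hX : IsClosed X) (hXc : Convex ℝ X) {t : ℤ}
    (hf : ∀ i, IsSmoothConvexLoss (ballRegion X δ) L₀ L₁ (f t i))
    (hf' : ∀ i, IsSmoothConvexLoss (ballRegion X δ) L₀ L₁ (f (t - 1) i))
    {u : ℤ → Fin N → Ω → UnitSphere d} {x : ℤ → Fin N → Ω → Vec d}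
    (hu : ∀ i, Measurable (u t i)) (hu' : ∀ i, Measurable (u (t - 1) i))
    (hx : ∀ i, Measurable (x t i)) (hx' : ∀ i, Measurable (x (t - 1) i))
    (hxX : ∀ i ω, x t i ω ∈ X) (hxX' : ∀ i ω, x (t - 1) i ω ∈ X)
    (hstep : ∀ ω i, IsProjection X (∑ j, A i j • (x t j ω -
      η • orfEstimator δ f (fun s k ↦ u s k ω) (fun s k ↦ x s k ω) t j)) (x (t + 1) i ω))
    (i : Fin N) : Measurable (x (t + 1) i) := by
  rcases isEmpty_or_nonempty Ω with hΩ | ⟨⟨ω₀⟩⟩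
  · exact measurable_of_empty _
  obtain ⟨P, hP, hPl⟩ := exists_isProjection hX hXc ⟨_, hxX i ω₀⟩
  have h₁ : ∀ j, Measurable fun ω ↦
      orfEstimator δ f (fun s k ↦ u s k ω) (fun s k ↦ x s k ω) t j := fun j ↦ by
    have h₂ := measurable_query_loss (hf j) (hx j) (hu j) (hxX j)
    have h₃ := measurable_query_loss (hf' j) (hx' j) (hu' j) (hxX' j)
    exact ((h₂.sub h₃).const_mul _).smul (measurable_subtype_coe.comp (hu j))
  have h₂ : x (t + 1) i = fun ω ↦ P (∑ j, A i j • (x t j ω -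
      η • orfEstimator δ f (fun s k ↦ u s k ω) (fun s k ↦ x s k ω) t j)) := funext fun ω ↦
    (hstep ω i).unique hXc (hP _)
  rw [h₂]
  refine hPl.continuous.measurable.comp ?_
  exact Finset.measurable_sum _ fun j _ ↦ ((hx j).sub ((h₁ j).const_smul η)).const_smul (A i j)

/-- The σ-algebra generated by the directions that are sampled before time `t`. -/
abbrev pastSigma (T : ℕ) (u : ℤ → Fin N → Ω → UnitSphere d) (t : ℤ) : MeasurableSpace Ω :=
  ⨆ p ∈ {p : ↥(Set.Icc (-1 : ℤ) T) × Fin N | (p.1 : ℤ) < t},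
    MeasurableSpace.comap (u p.1 p.2) inferInstance

theorem pastSigma_mono (u : ℤ → Fin N → Ω → UnitSphere d) {s t : ℤ} (hst : s ≤ t) :
    pastSigma T u s ≤ pastSigma T u t :=
  biSup_mono fun _ hp ↦ lt_of_lt_of_le hp hst

theorem measurable_pastSigma (u : ℤ → Fin N → Ω → UnitSphere d) {s t : ℤ} (hs : -1 ≤ s)
    (hs' : s ≤ T) (hst : s < t) (i : Fin N) : Measurable[pastSigma T u t] (u s i) := by
  rw [measurable_iff_comap_le]
  exact le_biSup (fun p : ↥(Set.Icc (-1 : ℤ) T) × Fin N ↦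
    MeasurableSpace.comap (u p.1 p.2) inferInstance) (i := (⟨s, hs, hs'⟩, i)) hst

theorem measurable_run_pastSigma (hX : IsClosed X) (hXc : Convex ℝ X)
    (hf : ∀ t : ℤ, -1 ≤ t → t ≤ T → ∀ i, IsSmoothConvexLoss (ballRegion X δ) L₀ L₁ (f t i))
    {xₚ x₀ : Fin N → Vec d} (hxₚ : ∀ i, xₚ i ∈ X) (hx₀ : ∀ i, x₀ i ∈ X)
    {u : ℤ → Fin N → Ω → UnitSphere d} {x : ℤ → Fin N → Ω → Vec d}
    (hrun : ∀ ω, IsORFRun X A η δ T f xₚ x₀ (fun t i ↦ u t i ω) (fun t i ↦ x t i ω))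
    (n : ℕ) (hn : n ≤ T + 1) :
    (∀ i, Measurable[pastSigma T u n] (x n i)) ∧
      ∀ i, Measurable[pastSigma T u n] (x ((n : ℤ) - 1) i) := by
  induction n with
  | zero =>
    refine ⟨fun i ↦ ?_, fun i ↦ ?_⟩
    · rw [show x ((0 : ℕ) : ℤ) i = fun _ ↦ x₀ i from funext fun ω ↦ (hrun ω).start i]
      exact measurable_const
    · rw [show x (((0 : ℕ) : ℤ) - 1) i = fun _ ↦ xₚ i from funext fun ω ↦ (hrun ω).previous i]
      exact measurable_const
  | succ n ih =>
    obtain ⟨h₁, h₂⟩ := ih (by omega)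
    have hle : pastSigma T u n ≤ pastSigma T u ((n + 1 : ℕ) : ℤ) :=
      pastSigma_mono u (by push_cast; omega)
    have hmem : ∀ t : ℤ, -1 ≤ t → t ≤ T + 1 → ∀ i ω, x t i ω ∈ X := fun t ht ht' i ω ↦
      (hrun ω).mem hxₚ hx₀ ht ht' i
    refine ⟨fun i ↦ ?_, fun i ↦ ?_⟩
    · rw [show ((n + 1 : ℕ) : ℤ) = (n : ℤ) + 1 by push_cast; rfl] at hle ⊢
      exact @measurable_orf_step d N X A η δ L₀ L₁ f Ω (pastSigma T u ((n : ℤ) + 1)) hX hXc n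
        (hf n (by omega) (by omega)) (hf (n - 1) (by omega) (by omega)) u x
        (measurable_pastSigma u (by omega) (by omega) (by omega))
        (measurable_pastSigma u (by omega) (by omega) (by omega))
        (fun j ↦ (h₁ j).mono hle le_rfl) (fun j ↦ (h₂ j).mono hle le_rfl)
        (hmem n (by omega) (by omega)) (hmem (n - 1) (by omega) (by omega))
        (fun ω ↦ (hrun ω).step n (by omega) (by omega)) i
    · rw [show ((n + 1 : ℕ) : ℤ) - 1 = (n : ℤ) by push_cast; ring]
      exact (h₁ i).mono hle le_rfl

theorem IsUniformSampling.indep_pastSigma [MeasurableSpace Ω] {μ : Measure Ω}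
    {u : ℤ → Fin N → Ω → UnitSphere d} (hu : IsUniformSampling T μ u) {t : ℤ} (ht : -1 ≤ t)
    (ht' : t ≤ T) (i : Fin N) :
    Indep (pastSigma T u t) (MeasurableSpace.comap (u t i) inferInstance) μ := by
  have h₁ := indep_iSup_of_disjoint
    (fun p : ↥(Set.Icc (-1 : ℤ) T) × Fin N ↦ (hu.measurable p.1 p.1.2.1 p.1.2.2 p.2).comap_le)
    hu.indep.iIndep (S := {p | (p.1 : ℤ) < t}) (T := {(⟨t, ht, ht'⟩, i)})
    (by simp [Set.disjoint_singleton_right])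
  simpa [pastSigma] using h₁

theorem pastSigma_le [mΩ : MeasurableSpace Ω] {μ : Measure Ω}
    {u : ℤ → Fin N → Ω → UnitSphere d} (hu : IsUniformSampling T μ u) (t : ℤ) :
    pastSigma T u t ≤ mΩ :=
  iSup₂_le fun p _ ↦ (hu.measurable p.1 p.1.2.1 p.1.2.2 p.2).comap_le

end Measurability

section Expectation

variable {d : ℕ} {X : Set (Vec d)} {δ L₀ L₁ r : ℝ} {Ω : Type*} [MeasurableSpace Ω]
  {μ : Measure Ω} [IsProbabilityMeasure μ]

theorem IsSmoothConvexLoss.integrable_comp (hL₀ : 0 ≤ L₀) (hδ : 0 ≤ δ) {g : Vec d → ℝ}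
    (hg : IsSmoothConvexLoss (ballRegion X δ) L₀ L₁ g) (h₀ : 0 ∈ X)
    (hr : X ⊆ Metric.closedBall 0 r) {z : Ω → Vec d} (hz : Measurable z)
    (hzD : ∀ ω, z ω ∈ ballRegion X δ) : Integrable (fun ω ↦ g (z ω)) μ :=
  Integrable.of_bound (hg.measurable_comp hz hzD).aestronglyMeasurable
    (|g 0| + L₀ * (r + δ)) (.of_forall fun ω ↦ hg.abs_le hL₀ hδ h₀ hr (hzD ω))

/-- The estimator, averaged over a direction `u` that is independent of the current decision `ξ`
and of the residual `c`, points away from `y` at least as much as the excess loss. -/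
theorem integral_sub_le_integral_estimator (hd : 0 < d) (hL₀ : 0 ≤ L₀) (hL₁ : 0 ≤ L₁)
    (hδ : 0 < δ) (h₀ : 0 ∈ X) (hr : X ⊆ Metric.closedBall 0 r) {g : Vec d → ℝ}
    (hg : IsSmoothConvexLoss (ballRegion X δ) L₀ L₁ g) {ξ : Ω → Vec d} {c : Ω → ℝ}
    {u : Ω → UnitSphere d} (hξ : Measurable ξ) (hc : Measurable c) (hu : Measurable u)
    (hξX : ∀ ω, ξ ω ∈ X) {M : ℝ} (hcM : ∀ ω, |c ω| ≤ M)
    (hlaw : μ.map u = uniformSphere d) (hind : IndepFun (fun ω ↦ (ξ ω, c ω)) u μ)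
    {y : Vec d} (hy : y ∈ X) :
    Integrable (fun ω ↦ inner ℝ ((d / δ * (g (ξ ω + δ • (u ω : Vec d)) - c ω)) • (u ω : Vec d))
        (ξ ω - y)) μ ∧
      ∫ ω, (g (ξ ω) - g y - L₁ * δ ^ 2) ∂μ ≤
        ∫ ω, inner ℝ ((d / δ * (g (ξ ω + δ • (u ω : Vec d)) - c ω)) • (u ω : Vec d))
          (ξ ω - y) ∂μ := by
  obtain ⟨k, hk, hgk⟩ := hg.exists_lipschitz_extension
  have hkm : Measurable k := hk.continuous.measurable
  set φ : (Vec d × ℝ) × UnitSphere d → ℝ := fun p ↦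
    d / δ * (k (p.1.1 + δ • (p.2 : Vec d)) - p.1.2) * inner ℝ (p.2 : Vec d) (p.1.1 - y) with hφ
  have hφm : Measurable φ := by fun_prop
  set W : Ω → Vec d × ℝ := fun ω ↦ (ξ ω, c ω) with hW
  have hWm : Measurable W := hξ.prodMk hc
  have hregion : ∀ ω (v : UnitSphere d), ξ ω + δ • (v : Vec d) ∈ ballRegion X δ := fun ω v ↦
    add_smul_mem_ballRegion (hξX ω) (norm_eq_of_mem_sphere v).le
  have hval : (fun ω ↦ inner ℝ ((d / δ * (g (ξ ω + δ • (u ω : Vec d)) - c ω)) • (u ω : Vec d))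
      (ξ ω - y)) = fun ω ↦ φ (W ω, u ω) := funext fun ω ↦ by
    rw [real_inner_smul_left, hgk (hregion ω (u ω))]
  have hr₀ : 0 ≤ r := (norm_nonneg _).trans (mem_closedBall_zero_iff.1 (hr hy))
  have hint : Integrable (fun ω ↦ φ (W ω, u ω)) μ := by
    refine Integrable.of_bound (hφm.comp (hWm.prodMk hu)).aestronglyMeasurable
      (d / δ * (|g 0| + L₀ * (r + δ) + M) * (1 * (r + r))) (.of_forall fun ω ↦ ?_)
    simp only [hφ, hW]
    rw [norm_mul, norm_mul, Real.norm_of_nonneg (by positivity : 0 ≤ (d : ℝ) / δ),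
      ← hgk (hregion ω (u ω))]
    have h₁ := hg.abs_le hL₀ hδ.le h₀ hr (hregion ω (u ω))
    have h₂ : ‖g (ξ ω + δ • (u ω : Vec d)) - c ω‖ ≤ |g 0| + L₀ * (r + δ) + M :=
      (abs_sub _ _).trans (add_le_add h₁ (hcM ω))
    have h₃ : ‖inner ℝ (u ω : Vec d) (ξ ω - y)‖ ≤ 1 * (r + r) := by
      refine (norm_inner_le_norm _ _).trans ?_
      rw [norm_eq_of_mem_sphere (u ω)]
      gcongr
      exact (norm_sub_le _ _).trans (add_le_add (mem_closedBall_zero_iff.1 (hr (hξX ω)))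
        (mem_closedBall_zero_iff.1 (hr hy)))
    have h₄ : 0 ≤ M := (abs_nonneg _).trans (hcM ω)
    gcongr
  have hpair : μ.map (fun ω ↦ (W ω, u ω)) = (μ.map W).prod (uniformSphere d) := by
    rw [← hlaw]
    exact hind.map_prod_eq_prod_map_map hWm.aemeasurable hu.aemeasurable
  have : IsProbabilityMeasure (uniformSphere d) := hlaw ▸ Measure.isProbabilityMeasure_map
    hu.aemeasurable
  have : IsProbabilityMeasure (μ.map W) := Measure.isProbabilityMeasure_map hWm.aemeasurable
  have hint' : Integrable φ ((μ.map W).prod (uniformSphere d)) := by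
    rw [← hpair, integrable_map_measure hφm.aestronglyMeasurable (hWm.prodMk hu).aemeasurable]
    exact hint
  have heq : ∫ ω, φ (W ω, u ω) ∂μ = ∫ ω, ∫ v, φ (W ω, v) ∂uniformSphere d ∂μ := by
    rw [← integral_map (hWm.prodMk hu).aemeasurable hφm.aestronglyMeasurable, hpair,
      integral_prod _ hint',
      integral_map hWm.aemeasurable hint'.integral_prod_left.aestronglyMeasurable]
  have hintW : Integrable (fun ω ↦ ∫ v, φ (W ω, v) ∂uniformSphere d) μ :=
    (integrable_map_measure hint'.integral_prod_left.aestronglyMeasurable hWm.aemeasurable).1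
      hint'.integral_prod_left
  rw [hval]
  refine ⟨hint, ?_⟩
  rw [heq]
  refine integral_mono ?_ hintW fun ω ↦ ?_
  · exact ((hg.integrable_comp hL₀ hδ.le h₀ hr hξ fun ω ↦ subset_ballRegion (hξX ω)).sub
      (integrable_const _)).sub (integrable_const _)
  · refine (hg.sub_le_integral_estimator hd hL₁ hδ (hξX ω) hy (c ω)).trans_eq ?_
    refine integral_congr_ae (.of_forall fun v ↦ ?_)
    simp only [hφ, hW]
    rw [hgk (hregion ω v)]

end Expectation

/-! ### The choice of parameters -/

section Parameters

variable {d N : ℕ} {ε L₀ : ℝ}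

theorem one_sub_mixingRate_sq_pos (hN : 0 < N) (hε₀ : 0 < ε) (hε₁ : ε < 1) :
    0 < 1 - mixingRate N ε ^ 2 := by
  have hN' : (1 : ℝ) ≤ N := by exact_mod_cast hN
  have h₁ : 0 < ε / (4 * (N : ℝ) ^ 2) := by positivity
  have h₂ : ε / (4 * (N : ℝ) ^ 2) < 1 := by
    rw [div_lt_one (by positivity)]
    nlinarith
  rw [mixingRate]
  nlinarith

theorem alphaConst_pos (hN : 0 < N) (hε₀ : 0 < ε) (hε₁ : ε < 1) : 0 < alphaConst N ε := by
  have h₁ := one_sub_mixingRate_sq_pos hN hε₀ hε₁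
  rw [alphaConst]
  positivity

/-- All that the step size asks of `α`: it exceeds the inverse of the dissipation constant. -/
theorem one_le_mul_alphaConst (hN : 0 < N) (hε₀ : 0 < ε) (hε₁ : ε < 1) :
    1 ≤ ε * alphaConst N ε := by
  have hN' : (1 : ℝ) ≤ (N : ℝ) ^ 2 := by
    have : (1 : ℝ) ≤ N := by exact_mod_cast hN
    nlinarith
  have h₁ := one_sub_mixingRate_sq_pos hN hε₀ hε₁
  have h₂ : 1 - mixingRate N ε ^ 2 ≤ ε := by
    have h₃ : ε / (4 * (N : ℝ) ^ 2) ≤ ε / 2 := by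
      gcongr
      linarith
    have h₄ : 0 ≤ ε / (4 * (N : ℝ) ^ 2) := by positivity
    rw [mixingRate]
    nlinarith
  have h₃ : 60 * (N : ℝ) ^ 2 / ε ≤ 60 * (N : ℝ) ^ 2 / (1 - mixingRate N ε ^ 2) := by gcongr
  have h₄ : ε * (60 * (N : ℝ) ^ 2 / ε) = 60 * (N : ℝ) ^ 2 := by field_simp
  have h₅ := mul_le_mul_of_nonneg_left h₃ hε₀.le
  rw [alphaConst, mul_add]
  linarith

theorem smoothingRadius_pos {T : ℕ} (hT : 1 ≤ T) : 0 < smoothingRadius T := by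
  have : (0 : ℝ) < T := by exact_mod_cast hT
  rw [smoothingRadius]
  positivity

theorem smoothingRadius_sq (T : ℕ) : smoothingRadius T ^ 2 = 4 / Real.sqrt T := by
  rw [smoothingRadius, div_pow, ← Real.rpow_natCast ((T : ℝ) ^ _), ← Real.rpow_mul (Nat.cast_nonneg T),
    Real.sqrt_eq_rpow]
  norm_num

theorem stepSize_eq (T : ℕ) : stepSize d N ε L₀ T =
    (Real.sqrt (3 * alphaConst N ε) * d * L₀ * Real.sqrt T)⁻¹ := by
  rw [stepSize, Real.sqrt_eq_rpow (T : ℝ), one_div]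

end Parameters

/-! ### The regret bound -/

theorem theorem2 (d N : ℕ) (hd : 0 < d) (hN : 0 < N) (L₀ L₁ ε rᵤ B : ℝ)
    (hL₀ : 0 < L₀) (hL₁ : 0 < L₁) (hε₀ : 0 < ε) (hε₁ : ε < 1) (hrᵤ : 0 < rᵤ) :
    ∃ C : ℝ, ∀ (T : ℕ), 1 ≤ T →
      ∀ (X : Set (Vec d)), IsClosed X → Convex ℝ X →
      (∃ rₗ > 0, Metric.closedBall 0 rₗ ⊆ X) → X ⊆ Metric.closedBall 0 rᵤ →
      ∀ (G : SimpleGraph (Fin N)) (A : Matrix (Fin N) (Fin N) ℝ), IsNetworkMatrix G A ε →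
      ∀ (f : ℤ → Fin N → Vec d → ℝ),
      (∀ t : ℤ, -1 ≤ t → t ≤ T → ∀ i,
        IsSmoothConvexLoss (ballRegion X (smoothingRadius T)) L₀ L₁ (f t i)) →
      (∀ i, increasingRate X (smoothingRadius T) f 0 i ≤ B) →
      ∀ (xₚ x₀ : Fin N → Vec d), (∀ i, xₚ i ∈ X) → (∀ i, x₀ i ∈ X) →
      ∀ (Ω : Type*) [MeasurableSpace Ω] (μ : Measure Ω) [IsProbabilityMeasure μ]
        (u : ℤ → Fin N → Ω → UnitSphere d), IsUniformSampling T μ u →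
      ∀ (x : ℤ → Fin N → Ω → Vec d),
      (∀ ω, IsORFRun X A (stepSize d N ε L₀ T) (smoothingRadius T) T f xₚ x₀
        (fun t i => u t i ω) (fun t i => x t i ω)) →
      ∀ (xstar : Vec d), xstar ∈ X →
      IsMinOn (fun y => ∑ t ∈ Finset.Icc (1 : ℤ) T, ∑ i, f t i y) X xstar →
      Integrable (fun ω => excessLoss T f (fun t i => x t i ω) xstar) μ ∧
      ∫ ω, excessLoss T f (fun t i => x t i ω) xstar ∂μ ≤
        C * max ((T : ℝ) ^ (1 / 2 : ℝ)) (accumulatedRate X (smoothingRadius T) T f ^ 2) := by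
  set α := alphaConst N ε with hα
  have hα₀ : 0 < α := alphaConst_pos hN hε₀ hε₁
  set κ := Real.sqrt (3 * α) * d * L₀ with hκ
  have hd' : (0 : ℝ) < d := by exact_mod_cast hd
  have hκ₀ : 0 < κ := by positivity
  have hκ₂ : κ ^ 2 = 3 * α * d ^ 2 * L₀ ^ 2 := by
    rw [hκ, mul_pow, mul_pow, Real.sq_sqrt (by positivity)]
  -- `C₁` collects the diameter of `X`, the part of the estimator that survives as `δ → 0`, and the
  -- smoothing bias; `C₂` is the coefficient of the drift.
  set C₁ := κ * (4 * N * rᵤ ^ 2) + 4 * N * κ / α + 4 * N * L₁ with hC₁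
  set C₂ := κ / (4 * α * L₀ ^ 2) with hC₂
  have hC₁₀ : 0 ≤ C₁ := by positivity
  have hC₂₀ : 0 ≤ C₂ := by positivity
  refine ⟨C₁ + C₂, ?_⟩
  intro T hT X hX hXc hball hr G A hA f hf _ xₚ x₀ hxₚ hx₀ Ω _ μ _ u hu x hrun xstar hxstar _
  obtain ⟨rₗ, hrₗ, hball⟩ := hball
  have h₀ : (0 : Vec d) ∈ X := hball (Metric.mem_closedBall_self hrₗ.le)
  have hδ := smoothingRadius_pos hT
  have hδ₂ := smoothingRadius_sq T
  have hT₀ : (0 : ℝ) < T := by exact_mod_cast hT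
  -- With `s = √T`, one has `η = 1 / (κ s)` and `δ² = 4 / s`.
  set s := Real.sqrt T with hs
  have hs₂ : s ^ 2 = T := Real.sq_sqrt hT₀.le
  have hs₁ : 1 ≤ s := Real.one_le_sqrt.2 (by exact_mod_cast hT)
  have hs₀ : 0 < s := by linarith
  have hη : stepSize d N ε L₀ T = (κ * s)⁻¹ := stepSize_eq T
  set δ := smoothingRadius T with hδdef
  set η := stepSize d N ε L₀ T with hηdef
  set Θ := accumulatedRate X δ T f with hΘ
  have hη₀ : 0 < η := by rw [hη]; positivity
  have hηd : 3 * d ^ 2 * η ^ 2 * L₀ ^ 2 = 1 / (α * T) := by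
    rw [hη, inv_pow, mul_pow, hκ₂, hs₂]
    field_simp
  have hηδ : 3 * d ^ 2 * η ^ 2 / δ ^ 2 * L₀ ^ 2 = 1 / (4 * α * s) := by
    rw [div_mul_eq_mul_div, hηd, hδ₂, ← hs₂]
    field_simp
  have hηε : 2 * (3 * d ^ 2 * η ^ 2 / δ ^ 2) * L₀ ^ 2 ≤ ε / 2 := by
    have h₁ := one_le_mul_alphaConst hN hε₀ hε₁
    rw [mul_assoc, hηδ, mul_one_div, div_le_div_iff₀ (by positivity) two_pos]
    nlinarith [mul_le_mul h₁ hs₁ zero_le_one (by positivity)]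
  have hmem : ∀ t : ℤ, -1 ≤ t → t ≤ T + 1 → ∀ i ω, x t i ω ∈ X := fun t ht ht' i ω ↦
    (hrun ω).mem hxₚ hx₀ ht ht' i
  have hpast : ∀ t : ℤ, 1 ≤ t → t ≤ T → ∀ i, Measurable[pastSigma T u t] (x t i) ∧
      Measurable[pastSigma T u t] (x (t - 1) i) := fun t ht ht' i ↦ by
    lift t to ℕ using by omega
    have h₁ := measurable_run_pastSigma hX hXc hf hxₚ hx₀ hrun t (by omega)
    exact ⟨h₁.1 i, h₁.2 i⟩
  have hmeas : ∀ t : ℤ, 1 ≤ t → t ≤ T → ∀ i, Measurable (x t i) := fun t ht ht' i ↦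
    (hpast t ht ht' i).1.mono (pastSigma_le hu t) le_rfl
  have hintf : ∀ t ∈ Finset.Icc (1 : ℤ) T, ∀ i ∈ Finset.univ,
      Integrable (fun ω ↦ f t i (x t i ω) - f t i xstar) μ := fun t ht i _ ↦ by
    rw [Finset.mem_Icc] at ht
    exact ((hf t (by omega) ht.2 i).integrable_comp hL₀.le hδ.le h₀ hr (hmeas t ht.1 ht.2 i)
      fun ω ↦ subset_ballRegion (hmem t (by omega) (by omega) i ω)).sub (integrable_const _)
  -- The decision and the residual of round `t` are functions of the past, hence independent of the
  -- direction sampled in round `t`.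
  have hkey : ∀ t ∈ Finset.Icc (1 : ℤ) T, ∀ i ∈ Finset.univ,
      Integrable (fun ω ↦ inner ℝ (orfEstimator δ f (fun s k ↦ u s k ω) (fun s k ↦ x s k ω) t i)
        (x t i ω - xstar)) μ ∧
      ∫ ω, (f t i (x t i ω) - f t i xstar - L₁ * δ ^ 2) ∂μ ≤
        ∫ ω, inner ℝ (orfEstimator δ f (fun s k ↦ u s k ω) (fun s k ↦ x s k ω) t i)
          (x t i ω - xstar) ∂μ := fun t ht i _ ↦ by
    rw [Finset.mem_Icc] at ht
    obtain ⟨ht, ht'⟩ := ht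
    have hf' := hf (t - 1) (by omega) (by omega) i
    have hm := hpast t ht ht' i
    have hc : Measurable[pastSigma T u t] fun ω ↦
        f (t - 1) i (x (t - 1) i ω + δ • (u (t - 1) i ω : Vec d)) :=
      @measurable_query_loss d X δ L₀ L₁ Ω (pastSigma T u t) _ hf' _ _ hm.2
        (measurable_pastSigma u (by omega) (by omega) (by omega) i)
        (hmem (t - 1) (by omega) (by omega) i)
    refine integral_sub_le_integral_estimator hd hL₀.le hL₁.le hδ h₀ hr (hf t (by omega) ht' i)
      (hmeas t ht ht' i) (hc.mono (pastSigma_le hu t) le_rfl) (hu.measurable t (by omega) ht' i)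
      (hmem t (by omega) (by omega) i) (M := |f (t - 1) i 0| + L₀ * (rᵤ + δ))
      (fun ω ↦ hf'.abs_le hL₀.le hδ.le h₀ hr (add_smul_mem_ballRegion
        (hmem (t - 1) (by omega) (by omega) i ω) (norm_eq_of_mem_sphere _).le))
      (hu.uniform t (by omega) ht' i) ?_ hxstar
    rw [IndepFun_iff_Indep]
    exact indep_of_indep_of_le_left (hu.indep_pastSigma (by omega) ht' i)
      (hm.1.prodMk hc).comap_le
  refine ⟨integrable_finsetSum _ fun t ht ↦ integrable_finsetSum _ (hintf t ht), ?_⟩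
  have hreg : ∫ ω, excessLoss T f (fun t i ↦ x t i ω) xstar ∂μ =
      ∑ t ∈ Finset.Icc (1 : ℤ) T, ∑ i, ∫ ω, (f t i (x t i ω) - f t i xstar) ∂μ := by
    simp only [excessLoss]
    rw [integral_finsetSum _ fun t ht ↦ integrable_finsetSum _ (hintf t ht)]
    exact Finset.sum_congr rfl fun t ht ↦ integral_finsetSum _ (hintf t ht)
  have hsum : ∫ ω, ∑ t ∈ Finset.Icc (1 : ℤ) T, ∑ i,
        inner ℝ (orfEstimator δ f (fun s k ↦ u s k ω) (fun s k ↦ x s k ω) t i)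
          (x t i ω - xstar) ∂μ =
      ∑ t ∈ Finset.Icc (1 : ℤ) T, ∑ i,
        ∫ ω, inner ℝ (orfEstimator δ f (fun s k ↦ u s k ω) (fun s k ↦ x s k ω) t i)
          (x t i ω - xstar) ∂μ := by
    rw [integral_finsetSum _ fun t ht ↦ integrable_finsetSum _ fun i hi ↦ (hkey t ht i hi).1]
    exact Finset.sum_congr rfl fun t ht ↦ integral_finsetSum _ fun i hi ↦ (hkey t ht i hi).1
  set R := 8 * N * rᵤ ^ 2 + 2 * (3 * d ^ 2 * η ^ 2 / δ ^ 2) * Θ ^ 2 +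
    24 * d ^ 2 * η ^ 2 * L₀ ^ 2 * N * T with hR
  have hpath : ∫ ω, ∑ t ∈ Finset.Icc (1 : ℤ) T, ∑ i,
      inner ℝ (orfEstimator δ f (fun s k ↦ u s k ω) (fun s k ↦ x s k ω) t i)
        (x t i ω - xstar) ∂μ ≤ R / (2 * η) := by
    have h₁ := integral_mono (μ := μ) (integrable_finsetSum _ fun t ht ↦
        integrable_finsetSum _ fun i hi ↦ (hkey t ht i hi).1)
      (integrable_const (R / (2 * η))) fun ω ↦ by
        rw [le_div_iff₀' (by positivity)]
        exact (hrun ω).sum_inner_orfEstimator_le hA hε₀.le hε₁.le hXc hL₀.le hδ h₀ hr hηε hf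
          hxₚ hx₀ hxstar
    simpa using h₁
  have hbias : ∑ t ∈ Finset.Icc (1 : ℤ) T, ∑ i, ∫ ω, (f t i (x t i ω) - f t i xstar) ∂μ ≤
      R / (2 * η) + T * (N * (L₁ * δ ^ 2)) := by
    have h₁ : (T * (N * (L₁ * δ ^ 2)) : ℝ) =
        ∑ _t ∈ Finset.Icc (1 : ℤ) T, ∑ _i : Fin N, L₁ * δ ^ 2 := by simp
    have h₂ := hsum.symm.trans_le hpath
    rw [h₁]
    refine le_trans ?_ (add_le_add h₂ le_rfl)
    rw [← Finset.sum_add_distrib]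
    refine Finset.sum_le_sum fun t ht ↦ ?_
    rw [← Finset.sum_add_distrib]
    refine Finset.sum_le_sum fun i hi ↦ ?_
    have h₃ := (hkey t ht i hi).2
    rw [integral_sub (hintf t ht i hi) (integrable_const _)] at h₃
    simp only [integral_const, probReal_univ, one_smul] at h₃
    linarith
  have hconst : R / (2 * η) + T * (N * (L₁ * δ ^ 2)) = C₁ * s + C₂ * Θ ^ 2 := by
    have h₁ : 3 * d ^ 2 * η ^ 2 / δ ^ 2 = 1 / (4 * α * s) / L₀ ^ 2 := by
      rw [← hηδ]
      field_simp
    have h₂ : 24 * d ^ 2 * η ^ 2 * L₀ ^ 2 * N * T = 8 * N / α := by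
      rw [show 24 * d ^ 2 * η ^ 2 * L₀ ^ 2 * N * T =
        8 * N * T * (3 * d ^ 2 * η ^ 2 * L₀ ^ 2) by ring, hηd]
      field_simp
    rw [hR, h₁, h₂, hδ₂, hη, ← hs₂, hC₁, hC₂]
    field_simp
    ring
  rw [hreg]
  refine (hbias.trans_eq hconst).trans ?_
  rw [show (T : ℝ) ^ (1 / 2 : ℝ) = s from (Real.sqrt_eq_rpow _).symm, add_mul C₁]
  exact add_le_add (mul_le_mul_of_nonneg_left (le_max_left _ _) hC₁₀)
    (mul_le_mul_of_nonneg_left (le_max_right _ _) hC₂₀)
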